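/- Let $\mathscr Z$ be a (real or complex) Banach space and $\mathscr B(\mathscr Z)$ the algebra of bounded linear operators on it. For $U:[c,d]\times[c,d]\to \mathscr Y$ ($\mathscr Y$ a Banach space) the Kurzweil integral $\int_c^d DU(\tau,t)$ is the limit, over gauges $\delta:[c,d]\to(0,\infty)$, of the sums $\sum_j[U(\tau_j,t_j)-U(\tau_j,t_{j-1})]$ over $\delta$-fine tagged divisions of $[c,d]$ (that is, $\tau_j\in[t_{j-1},t_j]\subset(\tau_j-\delta(\tau_j),\tau_j+\delta(\tau_j))$); moreover $\int_d^c=-\int_c^d$, $\int_c^c=0$, $\int_a^b d_\sigma[A(\sigma)]g(\sigma):=\int_a^b D[A(t)g(\tau)]$, and $\int_a^\infty:=\lim_{T\to\infty}\int_a^T$. Let $\Lambda:\mathbb R\to\mathscr B(\mathscr Z)$ have bounded variation on every compact interval, and let $Id+[\Lambda(t^+)-\Lambda(t)]$ and $Id-[\Lambda(t)-\Lambda(t^-)]$ be invertible in $\mathscr B(\mathscr Z)$ for every $t\in\mathbb R$. Let $\mathscr V:\mathbb R\times\mathbb R\to\mathscr B(\mathscr Z)$ be the fundamental operator of $\frac{dz}{d\tau}=D[\Lambda(t)z]$,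 i.e. $\mathscr V(t,s)=Id+\int_s^t d[\Lambda(r)]\mathscr V(r,s)$ for all $t,s$, with $\mathscr V(\cdot,s)$ locally of bounded variation for each $s$. Assume that this linear equation has an exponential dichotomy on $\mathbb R$: there are bounded projections $P(t)=P(t)^2\in\mathscr B(\mathscr Z)$, $t\in\mathbb R$, with $P(t)\mathscr V(t,s)=\mathscr V(t,s)P(s)$ for all $t,s$, and constants $K,\alpha>0$ with $\|\mathscr V(t,s)P(s)\|\le Ke^{-\alpha(t-s)}$ for $t\ge s$ and $\|\mathscr V(t,s)(Id-P(s))\|\le Ke^{\alpha(t-s)}$ for $t<s$. Let $F:\mathscr Z\times\mathbb R\to\mathscr Z$ and let $h:\mathbb R\to\mathbb R$ be nondecreasing and of bounded variation on $\mathbb R$ with $$\|F(z,t_2)-F(z,t_1)\|\le|h(t_2)-h(t_1)|,\qquad \|F(z,t_2)-F(z,t_1)-F(w,t_2)+F(w,t_1)\|\le\|z-w\|\,|h(t_2)-h(t_1)|$$ for all $z,w\in\mathscr Z$, $t_1,t_2\in\mathbb R$. Let $s\in\mathbb R$. A function $z:[s,\infty)\to\mathscr Z$ is a solution of $$\frac{dz}{d\tau}=D[\Lambda(t)z+F(z,t)]\tag{1}$$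 on $[s,\infty)$ if for all $s\le c\le d$ the integral $\int_c^dD[\Lambda(t)z(\tau)+F(z(\tau),t)]$ exists and equals $z(d)-z(c)$. If $z:[s,\infty)\to\mathscr Z$ is a bounded solution of (1), then all integrals below exist and for every $t\ge s$ $$z(t)=\mathscr V(t,s)P(s)z(s)+\int_s^tDF(z(\tau),\gamma)-\int_s^td_\sigma[\mathscr V(t,\sigma)P(\sigma)]\int_s^\sigma DF(z(\tau),\gamma)+\int_t^\infty d_\sigma[\mathscr V(t,\sigma)(Id-P(\sigma))]\int_s^\sigma DF(z(\tau),\gamma).\tag{2}$$ Conversely, every function $z:[s,\infty)\to\mathscr Z$ for which all integrals in (2) exist and (2) holds for every $t\ge s$ is a solution of (1) on $[s,\infty)$. -/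

import Mathlib

open Set Filter Topology

namespace GODE

/-- A tagged division of `[c, d]`: points `c = t₀ ≤ t₁ ≤ ⋯ ≤ tₙ = d` (`pt`) with tags
`tag i ∈ [pt i, pt (i + 1)]` for `i < n`.  (Values at indices `> n`, resp. `≥ n`, are irrelevant.) -/
structure TaggedDivision (c d : ℝ) where
  n : ℕ
  pt : ℕ → ℝ
  tag : ℕ → ℝ
  pt_zero : pt 0 = c
  pt_last : pt n = d
  tag_mem : ∀ i < n, tag i ∈ Icc (pt i) (pt (i + 1))

/-- `δ`-fineness: each subinterval lies in the open `δ`-neighbourhood of its tag. -/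
def TaggedDivision.IsFine {c d : ℝ} (D : TaggedDivision c d) (δ : ℝ → ℝ) : Prop :=
  ∀ i < D.n, Icc (D.pt i) (D.pt (i + 1)) ⊆ Ioo (D.tag i - δ (D.tag i)) (D.tag i + δ (D.tag i))

section Integral

variable {E : Type*} [NormedAddCommGroup E]

/-- The sum `∑ [U(tagᵢ, tᵢ₊₁) - U(tagᵢ, tᵢ)]`. -/
def TaggedDivision.sum {c d : ℝ} (D : TaggedDivision c d) (U : ℝ → ℝ → E) : E :=
  ∑ i ∈ Finset.range D.n, (U (D.tag i) (D.pt (i + 1)) - U (D.tag i) (D.pt i))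

/-- For `c ≤ d`: the Kurzweil integral `∫_c^d DU(τ, t)` exists and equals `J`. -/
def HasKurzweilIntegralOn (U : ℝ → ℝ → E) (c d : ℝ) (J : E) : Prop :=
  ∀ ε > 0, ∃ δ : ℝ → ℝ, (∀ τ ∈ Icc c d, 0 < δ τ) ∧
    ∀ D : TaggedDivision c d, D.IsFine δ → ‖D.sum U - J‖ < ε

/-- The oriented Kurzweil integral `∫_a^b DU(τ, t)` exists and equals `J`, with the convention
`∫_a^b = -∫_b^a` (so `∫_a^a = 0`). -/
def HasKurzweilIntegral (U : ℝ → ℝ → E) (a b : ℝ) (J : E) : Prop :=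
  (a ≤ b → HasKurzweilIntegralOn U a b J) ∧ (b ≤ a → HasKurzweilIntegralOn U b a (-J))

end Integral

section Equations

variable {𝕜 : Type*} [RCLike 𝕜] {Z : Type*} [NormedAddCommGroup Z] [NormedSpace 𝕜 Z]

/-- The Perron–Stieltjes integral `∫_a^b d[A(σ)] g(σ)`, the Kurzweil integral with sums
`∑ [A(tᵢ₊₁) - A(tᵢ)] g(tagᵢ)`, exists and equals `J`. -/
def HasPerronStieltjes (A : ℝ → Z →L[𝕜] Z) (g : ℝ → Z) (a b : ℝ) (J : Z) : Prop :=
  HasKurzweilIntegral (fun τ t => A t (g τ)) a b J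

/-- The improper integral `∫_a^∞ d[A(σ)] g(σ) = lim_{T → ∞} ∫_a^T d[A(σ)] g(σ)` exists and
equals `J`. -/
def HasPerronStieltjesAtTop (A : ℝ → Z →L[𝕜] Z) (g : ℝ → Z) (a : ℝ) (J : Z) : Prop :=
  ∃ I : ℝ → Z, (∀ T ≥ a, HasPerronStieltjes A g a T (I T)) ∧ Tendsto I atTop (𝓝 J)

/-- The standing assumptions on the linear part: `Λ` is of bounded variation on every compact
interval, and `Id + [Λ(t⁺) - Λ(t)]` and `Id - [Λ(t) - Λ(t⁻)]` are invertible in the algebra of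
bounded operators for every `t`. -/
structure IsAdmissible (Λ : ℝ → Z →L[𝕜] Z) : Prop where
  locallyBV : LocallyBoundedVariationOn Λ univ
  isUnit_right : ∀ t, IsUnit (1 + (Function.rightLim Λ t - Λ t))
  isUnit_left : ∀ t, IsUnit (1 - (Λ t - Function.leftLim Λ t))

/-- `V` is a fundamental solution operator of `dz/dτ = D[Λ(t)z]`:
`V(t, s) = Id + ∫_s^t d[Λ(r)] V(r, s)` for all `t, s`, and each `V(·, s)` is locally of bounded
variation. -/
structure IsFundamentalOperator (Λ : ℝ → Z →L[𝕜] Z) (V : ℝ → ℝ → Z →L[𝕜] Z) : Prop where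
  integral_eq : ∀ t s,
    HasKurzweilIntegral (fun τ r => (Λ r).comp (V τ s)) s t (V t s - ContinuousLinearMap.id 𝕜 Z)
  locallyBV : ∀ s, LocallyBoundedVariationOn (fun t => V t s) univ

/-- Exponential dichotomy on `ℝ`, with projections `P(t)`, of the linear equation with fundamental
operator `V`. -/
structure IsExponentialDichotomy (V : ℝ → ℝ → Z →L[𝕜] Z) (P : ℝ → Z →L[𝕜] Z) : Prop where
  proj : ∀ t, (P t).comp (P t) = P t
  invariant : ∀ t s, (P t).comp (V t s) = (V t s).comp (P s)
  bounds : ∃ K > 0, ∃ α > 0,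
    (∀ t s : ℝ, s ≤ t → ‖(V t s).comp (P s)‖ ≤ K * Real.exp (-α * (t - s))) ∧
    (∀ t s : ℝ, t < s →
      ‖(V t s).comp (ContinuousLinearMap.id 𝕜 Z - P s)‖ ≤ K * Real.exp (α * (t - s)))

/-- The class `𝓕(Z × ℝ, h)`, for a nondecreasing `h : ℝ → ℝ`. -/
structure IsClassF (F : Z → ℝ → Z) (h : ℝ → ℝ) : Prop where
  mono : Monotone h
  bound : ∀ z t₁ t₂, ‖F z t₂ - F z t₁‖ ≤ |h t₂ - h t₁|
  lipschitz : ∀ z w t₁ t₂,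
    ‖F z t₂ - F z t₁ - F w t₂ + F w t₁‖ ≤ ‖z - w‖ * |h t₂ - h t₁|

/-- `z` (only its values on `[s, ∞)` matter) is a solution on `[s, ∞)` of the generalized ODE
`dz/dτ = D[Λ(t)z + F(z, t)]`: for all `s ≤ c ≤ d` the Kurzweil integral below exists and
`z(d) = z(c) + ∫_c^d D[Λ(t)z(τ) + F(z(τ), t)]`. -/
def IsSolution (Λ : ℝ → Z →L[𝕜] Z) (F : Z → ℝ → Z) (s : ℝ) (z : ℝ → Z) : Prop :=
  ∀ c d, s ≤ c → c ≤ d →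
    HasKurzweilIntegral (fun τ t => Λ t (z τ) + F (z τ) t) c d (z d - z c)

/-- `z` (only its values on `[s, ∞)` matter) satisfies on `[s, ∞)` the generalized
Lyapunov–Perron equation: all the integrals in it exist and, with `g(σ) = ∫_s^σ DF(z(τ), γ)`,
`z(t) = V(t,s)P(s)z(s) + g(t) - ∫_s^t d_σ[V(t,σ)P(σ)] g(σ) + ∫_t^∞ d_σ[V(t,σ)(Id - P(σ))] g(σ)`
for every `t ≥ s`. -/
def SolvesLyapunovPerron (V : ℝ → ℝ → Z →L[𝕜] Z) (P : ℝ → Z →L[𝕜] Z) (F : Z → ℝ → Z)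
    (s : ℝ) (z : ℝ → Z) : Prop :=
  ∃ g : ℝ → Z, (∀ σ ≥ s, HasKurzweilIntegral (fun τ γ => F (z τ) γ) s σ (g σ)) ∧
    ∀ t ≥ s, ∃ J₁ J₂ : Z,
      HasPerronStieltjes (fun σ => (V t σ).comp (P σ)) g s t J₁ ∧
      HasPerronStieltjesAtTop
        (fun σ => (V t σ).comp (ContinuousLinearMap.id 𝕜 Z - P σ)) g t J₂ ∧
      z t = V t s (P s (z s)) + g t - J₁ + J₂

end Equations

end GODE

open Set Filter Topology

namespace GODE

/-! The integral equations are replaced by pointwise relations: `f` is a primitive of `DU` when, at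
every `τ`, `f u - f τ - (U τ u - U τ τ) = o(ψ u - ψ τ)` for a monotone `ψ`. Over fine divisions such
errors telescope, so the relation implies integrability, and product rules become algebra with
little-o terms. Primitives exist when the mixed increments of `U` are locally bounded by products of
increments of `ψ` (`exists_isPrimitiveAt`); this covers `F(z(τ), t)`, `Λ(t)z(τ)` and `V(s,t)g(τ)`.

The jump conditions make `V(u,τ)` invertible for `u` near `τ`, whence the cocycle law
(`IsEvolution.mul`) and the adjoint equation for `V(s,·)`. Put `g(t) = ∫_s^t DF` and let `w` be a
primitive of `d[V(s,·)]g`. For a solution, `V(s,t)(z(t) - g(t)) + w(t)` is constant, that is, `z(t)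
= V(t,s)(z(s) - (w(t) - w(s))) + g(t)`.

Since `V(t,σ)P(σ) = V(t,s)P(s)V(s,σ)`, and likewise for `1 - P`, the integrals in the
Lyapunov–Perron equation are images of increments of `w`. If `z` is bounded, so is `z - g`, and the
dichotomy gives `(1 - P(s))V(s,t)(z(t) - g(t)) → 0`. Hence `(1 - P(s))(w(T) - w(s)) → (1 -
P(s))z(s)`: the improper integral converges to the required value. Conversely, the Lyapunov–Perron
equation collapses to `z(t) = V(t,s)(c - w(t)) + g(t)` with `c` constant, which solves the equation
by variation of constants. -/

/-- Interval form of Cousin's lemma. -/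
theorem interval_induction {p : ℝ → ℝ → Prop} {a b : ℝ} (hab : a ≤ b)
    (glue : ∀ u v w, a ≤ u → u ≤ v → v ≤ w → w ≤ b → p u v → p v w → p u w)
    (loc : ∀ x ∈ Icc a b, ∃ η > 0, (∀ u, a ≤ u → x - η < u → u ≤ x → p u x) ∧
      ∀ v, v ≤ b → x ≤ v → v < x + η → p x v) : p a b := by
  set S : Set ℝ := {t | t ∈ Icc a b ∧ p a t} with hS
  have haS : a ∈ S := by
    obtain ⟨η, hη, h1, -⟩ := loc a ⟨le_rfl, hab⟩
    exact ⟨⟨le_rfl, hab⟩, h1 a le_rfl (by linarith) le_rfl⟩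
  have hbd : BddAbove S := ⟨b, fun t ht => ht.1.2⟩
  have hac : a ≤ sSup S := le_csSup hbd haS
  have hcb : sSup S ≤ b := csSup_le ⟨a, haS⟩ fun t ht => ht.1.2
  obtain ⟨η, hη, h1, h2⟩ := loc (sSup S) ⟨hac, hcb⟩
  obtain ⟨u, huS, hu⟩ := exists_lt_of_lt_csSup ⟨a, haS⟩ (sub_lt_self (sSup S) hη)
  have huc : u ≤ sSup S := le_csSup hbd huS
  have hpc : p a (sSup S) :=
    glue a u _ le_rfl huS.1.1 huc hcb huS.2 (h1 u huS.1.1 hu huc)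
  rcases hcb.eq_or_lt with hc | hc
  · rwa [← hc]
  · have hv1 : sSup S ≤ min (sSup S + η / 2) b := le_min (by linarith) hcb
    have hv2 : min (sSup S + η / 2) b < sSup S + η := (min_le_left _ _).trans_lt (by linarith)
    have hv : min (sSup S + η / 2) b ∈ S :=
      ⟨⟨hac.trans hv1, min_le_right _ _⟩,
        glue a _ _ le_rfl hac hv1 (min_le_right _ _) hpc (h2 _ (min_le_right _ _) hv1 hv2)⟩
    have := le_csSup hbd hv
    rcases min_le_iff.1 this with h | h <;> linarith

/-! ### Tagged divisions and Cousin's lemma -/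

section Divisions

variable {E : Type*} [NormedAddCommGroup E] {c d e : ℝ}

theorem TaggedDivision.pt_mono (D : TaggedDivision c d) {i j : ℕ} (hij : i ≤ j) (hj : j ≤ D.n) :
    D.pt i ≤ D.pt j := by
  induction j, hij using Nat.le_induction with
  | base => exact le_rfl
  | succ j hij ih =>
    have := D.tag_mem j (by omega)
    exact (ih (by omega)).trans (this.1.trans this.2)

theorem TaggedDivision.le_pt (D : TaggedDivision c d) {i : ℕ} (hi : i ≤ D.n) : c ≤ D.pt i :=
  D.pt_zero.symm.le.trans (D.pt_mono (Nat.zero_le i) hi)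

theorem TaggedDivision.pt_le (D : TaggedDivision c d) {i : ℕ} (hi : i ≤ D.n) : D.pt i ≤ d := by
  have := D.pt_mono hi le_rfl
  rwa [D.pt_last] at this

/-- The division with a single subinterval. -/
def TaggedDivision.single (τ : ℝ) (h : τ ∈ Icc c d) : TaggedDivision c d where
  n := 1
  pt i := if i = 0 then c else d
  tag _ := τ
  pt_zero := by simp
  pt_last := by simp
  tag_mem i hi := by
    obtain rfl : i = 0 := by omega
    simpa using h

/-- Concatenation of divisions of adjacent intervals. -/
def TaggedDivision.append (D₁ : TaggedDivision c d) (D₂ : TaggedDivision d e) :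
    TaggedDivision c e where
  n := D₁.n + D₂.n
  pt i := if i ≤ D₁.n then D₁.pt i else D₂.pt (i - D₁.n)
  tag i := if i < D₁.n then D₁.tag i else D₂.tag (i - D₁.n)
  pt_zero := by simp [D₁.pt_zero]
  pt_last := by
    rcases Nat.eq_zero_or_pos D₂.n with h | h
    · have h1 := D₂.pt_zero
      have h2 := D₂.pt_last
      rw [h] at h2
      simp [h, D₁.pt_last, ← h1, h2]
    · rw [if_neg (by omega), Nat.add_sub_cancel_left, D₂.pt_last]
  tag_mem i hi := by
    rcases lt_or_ge i D₁.n with h | h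
    · simpa [h, h.le, Nat.succ_le_of_lt h] using D₁.tag_mem i h
    · have := D₂.tag_mem (i - D₁.n) (by omega)
      rw [if_neg h.not_gt, if_neg (show ¬ i + 1 ≤ D₁.n by omega), Nat.sub_add_comm h]
      rcases h.eq_or_lt with h' | h'
      · rw [if_pos h'.ge, ← h', D₁.pt_last]
        simpa [← h', D₂.pt_zero] using this
      · rwa [if_neg h'.not_ge]

theorem TaggedDivision.append_pt_left (D₁ : TaggedDivision c d) (D₂ : TaggedDivision d e)
    {i : ℕ} (hi : i ≤ D₁.n) : (D₁.append D₂).pt i = D₁.pt i := if_pos hi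

theorem TaggedDivision.append_pt_right (D₁ : TaggedDivision c d) (D₂ : TaggedDivision d e)
    (i : ℕ) : (D₁.append D₂).pt (D₁.n + i) = D₂.pt i := by
  rcases Nat.eq_zero_or_pos i with h | h
  · subst h
    rw [Nat.add_zero, D₁.append_pt_left D₂ le_rfl, D₁.pt_last, D₂.pt_zero]
  · simp only [TaggedDivision.append]
    rw [if_neg (by omega), Nat.add_sub_cancel_left]

theorem TaggedDivision.append_tag_left (D₁ : TaggedDivision c d) (D₂ : TaggedDivision d e)
    {i : ℕ} (hi : i < D₁.n) : (D₁.append D₂).tag i = D₁.tag i := if_pos hi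

theorem TaggedDivision.append_tag_right (D₁ : TaggedDivision c d) (D₂ : TaggedDivision d e)
    (i : ℕ) : (D₁.append D₂).tag (D₁.n + i) = D₂.tag i := by
  simp [TaggedDivision.append]

theorem TaggedDivision.append_sum (D₁ : TaggedDivision c d) (D₂ : TaggedDivision d e)
    (U : ℝ → ℝ → E) : (D₁.append D₂).sum U = D₁.sum U + D₂.sum U := by
  have hn : (D₁.append D₂).n = D₁.n + D₂.n := rfl
  unfold TaggedDivision.sum
  rw [hn, Finset.sum_range_add]
  congr 1
  · refine Finset.sum_congr rfl fun i hi => ?_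
    have hi := Finset.mem_range.1 hi
    rw [append_tag_left _ _ hi, append_pt_left _ _ hi.le, append_pt_left _ _ hi]
  · refine Finset.sum_congr rfl fun i _ => ?_
    rw [append_tag_right, append_pt_right, add_assoc, append_pt_right]

theorem TaggedDivision.IsFine.append {D₁ : TaggedDivision c d} {D₂ : TaggedDivision d e}
    {δ : ℝ → ℝ} (h₁ : D₁.IsFine δ) (h₂ : D₂.IsFine δ) : (D₁.append D₂).IsFine δ := by
  intro i hi
  have hn : (D₁.append D₂).n = D₁.n + D₂.n := rfl
  rcases lt_or_ge i D₁.n with h | h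
  · rw [append_tag_left _ _ h, append_pt_left _ _ h.le, append_pt_left _ _ h]
    exact h₁ i h
  · obtain ⟨k, rfl⟩ := Nat.exists_eq_add_of_le h
    rw [append_tag_right, append_pt_right, add_assoc, append_pt_right]
    exact h₂ k (by omega)

theorem TaggedDivision.IsFine.mono {D : TaggedDivision c d} {δ δ' : ℝ → ℝ} (h : D.IsFine δ)
    (hδ : ∀ τ, δ τ ≤ δ' τ) : D.IsFine δ' := fun i hi =>
  (h i hi).trans (Ioo_subset_Ioo (by linarith [hδ (D.tag i)]) (by linarith [hδ (D.tag i)]))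

/-- Cousin's lemma. -/
theorem exists_isFine (hcd : c ≤ d) {δ : ℝ → ℝ} (hδ : ∀ τ ∈ Icc c d, 0 < δ τ) :
    ∃ D : TaggedDivision c d, D.IsFine δ := by
  refine interval_induction (p := fun u v => ∃ D : TaggedDivision u v, D.IsFine δ) hcd
    (fun u v w _ _ _ _ ⟨D₁, h₁⟩ ⟨D₂, h₂⟩ => ⟨D₁.append D₂, h₁.append h₂⟩) fun x hx =>
    ⟨δ x, hδ x hx, fun u _ h1 h2 => ⟨.single x ⟨h2, le_rfl⟩, ?_⟩,
      fun v _ h1 h2 => ⟨.single x ⟨le_rfl, h1⟩, ?_⟩⟩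
  all_goals
    intro i hi
    obtain rfl : i = 0 := by simpa [TaggedDivision.single] using hi
    have := hδ x hx
    intro y hy
    simp only [TaggedDivision.single, if_true, Nat.zero_add, one_ne_zero, if_false] at hy ⊢
    exact ⟨by linarith [hy.1], by linarith [hy.2]⟩

theorem TaggedDivision.norm_sub_sum_le (D : TaggedDivision c d) {δ : ℝ → ℝ} (hD : D.IsFine δ)
    {U : ℝ → ℝ → E} {f : ℝ → E} {φ : ℝ → ℝ}
    (h : ∀ τ u v, c ≤ u → u ≤ τ → τ ≤ v → v ≤ d → τ - δ τ < u → v < τ + δ τ →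
      ‖f v - f u - (U τ v - U τ u)‖ ≤ φ v - φ u) :
    ‖f d - f c - D.sum U‖ ≤ φ d - φ c := by
  have h1 : f d - f c = ∑ i ∈ Finset.range D.n, (f (D.pt (i + 1)) - f (D.pt i)) := by
    rw [Finset.sum_range_sub (fun i => f (D.pt i)), D.pt_zero, D.pt_last]
  have h2 : φ d - φ c = ∑ i ∈ Finset.range D.n, (φ (D.pt (i + 1)) - φ (D.pt i)) := by
    rw [Finset.sum_range_sub (fun i => φ (D.pt i)), D.pt_zero, D.pt_last]
  rw [h1, h2, TaggedDivision.sum, ← Finset.sum_sub_distrib]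
  refine norm_sum_le_of_le _ fun i hi => ?_
  have hi := Finset.mem_range.1 hi
  have ht := D.tag_mem i hi
  have hle := ht.1.trans ht.2
  exact h _ _ _ (D.le_pt hi.le) ht.1 ht.2 (D.pt_le hi) (hD i hi (left_mem_Icc.2 hle)).1
    (hD i hi (right_mem_Icc.2 hle)).2

end Divisions

/-! ### Elementary properties of the Kurzweil integral -/

section Kurzweil

variable {E : Type*} [NormedAddCommGroup E] {U U' : ℝ → ℝ → E} {c d e : ℝ} {J J' : E}

theorem HasKurzweilIntegralOn.unique (hcd : c ≤ d) (h : HasKurzweilIntegralOn U c d J)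
    (h' : HasKurzweilIntegralOn U c d J') : J = J' := by
  by_contra hne
  have hpos : 0 < ‖J - J'‖ / 2 := by
    have := norm_pos_iff.2 (sub_ne_zero.2 hne); linarith
  obtain ⟨δ, hδ, H⟩ := h _ hpos
  obtain ⟨δ', hδ', H'⟩ := h' _ hpos
  obtain ⟨D, hD⟩ := exists_isFine hcd (δ := fun τ => min (δ τ) (δ' τ))
    fun τ hτ => lt_min (hδ τ hτ) (hδ' τ hτ)
  have h1 := H D (hD.mono fun _ => min_le_left _ _)
  have h2 := H' D (hD.mono fun _ => min_le_right _ _)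
  have : ‖J - J'‖ ≤ ‖D.sum U - J'‖ + ‖D.sum U - J‖ := by
    rw [show J - J' = (D.sum U - J') - (D.sum U - J) by abel]; exact norm_sub_le _ _
  linarith

theorem HasKurzweilIntegralOn.norm_le (hcd : c ≤ d) (h : HasKurzweilIntegralOn U c d J)
    {φ : ℝ → ℝ} (hφ : ∀ τ u v, c ≤ u → u ≤ τ → τ ≤ v → v ≤ d → ‖U τ v - U τ u‖ ≤ φ v - φ u) :
    ‖J‖ ≤ φ d - φ c := by
  refine le_of_forall_pos_le_add fun ε hε => ?_
  obtain ⟨δ, hδ, H⟩ := h ε hε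
  obtain ⟨D, hD⟩ := exists_isFine hcd hδ
  have h1 := H D hD
  have h2 : ‖D.sum U‖ ≤ φ d - φ c := by
    have := D.norm_sub_sum_le hD (U := U) (f := fun _ => 0) (φ := φ)
      fun τ u v h1 h2 h3 h4 _ _ => by simpa [norm_sub_rev] using hφ τ u v h1 h2 h3 h4
    simpa using this
  have h3 : ‖J‖ ≤ ‖D.sum U‖ + ‖D.sum U - J‖ := by
    conv_lhs => rw [show J = D.sum U - (D.sum U - J) by abel]
    exact norm_sub_le _ _
  linarith

theorem HasKurzweilIntegralOn.add {J₂ : E} (h : HasKurzweilIntegralOn U c d J)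
    (h' : HasKurzweilIntegralOn U' c d J₂) :
    HasKurzweilIntegralOn (fun τ t => U τ t + U' τ t) c d (J + J₂) := by
  intro ε hε
  obtain ⟨δ, hδ, H⟩ := h (ε / 2) (half_pos hε)
  obtain ⟨δ', hδ', H'⟩ := h' (ε / 2) (half_pos hε)
  refine ⟨fun τ => min (δ τ) (δ' τ), fun τ hτ => lt_min (hδ τ hτ) (hδ' τ hτ), fun D hD => ?_⟩
  have h1 := H D (hD.mono fun _ => min_le_left _ _)
  have h2 := H' D (hD.mono fun _ => min_le_right _ _)
  have h3 : D.sum (fun τ t => U τ t + U' τ t) = D.sum U + D.sum U' := by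
    simp only [TaggedDivision.sum, ← Finset.sum_add_distrib]
    exact Finset.sum_congr rfl fun i _ => by abel
  rw [h3, add_sub_add_comm]
  exact (norm_add_le _ _).trans_lt (by linarith)

theorem HasKurzweilIntegralOn.congr (h : HasKurzweilIntegralOn U c d J)
    (hU : ∀ τ ∈ Icc c d, ∀ t, U τ t = U' τ t) : HasKurzweilIntegralOn U' c d J := by
  intro ε hε
  obtain ⟨δ, hδ, H⟩ := h ε hε
  refine ⟨δ, hδ, fun D hD => ?_⟩
  convert H D hD using 3
  refine Finset.sum_congr rfl fun i hi => ?_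
  have hi := Finset.mem_range.1 hi
  have ht := D.tag_mem i hi
  have hm : D.tag i ∈ Icc c d := ⟨(D.le_pt hi.le).trans ht.1, ht.2.trans (D.pt_le hi)⟩
  rw [hU _ hm, hU _ hm]

/-- No Cauchy criterion is needed: any fine division of `[d, e]` is completed by a fine division of
`[c, d]`, and both sums are compared with the known integrals. -/
theorem HasKurzweilIntegralOn.sub_left (hcd : c ≤ d) (h : HasKurzweilIntegralOn U c d J)
    (h' : HasKurzweilIntegralOn U c e J') : HasKurzweilIntegralOn U d e (J' - J) := by
  intro ε hε
  rcases le_or_gt d e with hde | hde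
  swap
  · exact ⟨fun _ => 1, fun _ _ => one_pos, fun D _ => absurd
      ((D.le_pt le_rfl).trans (D.pt_last.le)) hde.not_ge⟩
  obtain ⟨δ, hδ, H⟩ := h (ε / 2) (half_pos hε)
  obtain ⟨δ', hδ', H'⟩ := h' (ε / 2) (half_pos hε)
  refine ⟨δ', fun τ hτ => hδ' τ ⟨hcd.trans hτ.1, hτ.2⟩, fun D hD => ?_⟩
  obtain ⟨D₁, hD₁⟩ := exists_isFine hcd (δ := fun τ => min (δ τ) (δ' τ))
    fun τ hτ => lt_min (hδ τ hτ) (hδ' τ ⟨hτ.1, hτ.2.trans hde⟩)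
  have h1 := H D₁ (hD₁.mono fun _ => min_le_left _ _)
  have h2 := H' _ ((hD₁.mono fun _ => min_le_right _ _).append hD)
  rw [TaggedDivision.append_sum] at h2
  rw [show D.sum U - (J' - J) = (D₁.sum U + D.sum U - J') - (D₁.sum U - J) by abel]
  exact (norm_sub_le _ _).trans_lt (by linarith)

theorem HasKurzweilIntegral.unique {a b : ℝ} (h : HasKurzweilIntegral U a b J)
    (h' : HasKurzweilIntegral U a b J') : J = J' := by
  rcases le_total a b with hab | hab
  · exact (h.1 hab).unique hab (h'.1 hab)
  · exact neg_injective ((h.2 hab).unique hab (h'.2 hab))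

theorem HasKurzweilIntegralOn.hasKurzweilIntegral (hcd : c ≤ d)
    (h : HasKurzweilIntegralOn U c d J) : HasKurzweilIntegral U c d J := by
  refine ⟨fun _ => h, fun hdc => ?_⟩
  obtain rfl := le_antisymm hcd hdc
  have h0 : J = 0 := norm_le_zero_iff.1 <| by
    simpa using h.norm_le le_rfl (φ := fun _ => 0) fun τ u v h1 h2 h3 h4 => by
      obtain rfl : u = v := by linarith
      simp
  simpa [h0] using h

end Kurzweil

/-! ### Primitives relative to a monotone function, and their existence -/

section Primitive

variable {E : Type*} [NormedAddCommGroup E] {U : ℝ → ℝ → E} {ψ : ℝ → ℝ}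

/-- `f` is a primitive of `DU` at `τ` relative to the (monotone) function `ψ`: the increments of
`f` and of `U τ` at `τ` agree up to a small multiple of the increment of `ψ`. -/
def IsPrimitiveAt (ψ : ℝ → ℝ) (U : ℝ → ℝ → E) (f : ℝ → E) (τ : ℝ) : Prop :=
  (fun u => f u - f τ - (U τ u - U τ τ)) =o[𝓝 τ] fun u => ψ u - ψ τ

/-- Each subinterval is split at its tag; by monotonicity of `ψ` the two errors add up to `ε` times
its increment, which telescopes. -/
theorem TaggedDivision.norm_sub_sum_le_of_gauge (hψ : Monotone ψ) {a b ε : ℝ} {δ : ℝ → ℝ}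
    {f : ℝ → E}
    (hf : ∀ τ ∈ Icc a b, ∀ u ∈ Icc a b, |u - τ| < δ τ →
      ‖f u - f τ - (U τ u - U τ τ)‖ ≤ ε * |ψ u - ψ τ|)
    {c d : ℝ} (hac : a ≤ c) (hdb : d ≤ b) (D : TaggedDivision c d) (hD : D.IsFine δ) :
    ‖f d - f c - D.sum U‖ ≤ ε * (ψ d - ψ c) := by
  rw [mul_sub]
  refine D.norm_sub_sum_le hD (φ := fun t => ε * ψ t) fun τ u v h1 h2 h3 h4 h5 h6 => ?_
  have hτ : τ ∈ Icc a b := ⟨by linarith, by linarith⟩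
  have hv := hf τ hτ v ⟨by linarith, by linarith⟩ (abs_lt.2 ⟨by linarith, by linarith⟩)
  have hu := hf τ hτ u ⟨by linarith, by linarith⟩ (abs_lt.2 ⟨by linarith, by linarith⟩)
  rw [abs_of_nonneg (sub_nonneg.2 (hψ h3))] at hv
  rw [abs_of_nonpos (sub_nonpos.2 (hψ h2))] at hu
  calc ‖f v - f u - (U τ v - U τ u)‖
      = ‖(f v - f τ - (U τ v - U τ τ)) - (f u - f τ - (U τ u - U τ τ))‖ := by congr 1; abel
    _ ≤ _ := norm_sub_le _ _
    _ ≤ _ := by linarith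

theorem hasKurzweilIntegralOn_of_isPrimitiveAt (hψ : Monotone ψ) {f : ℝ → E} {c d : ℝ}
    (hf : ∀ τ ∈ Icc c d, IsPrimitiveAt ψ U f τ) :
    HasKurzweilIntegralOn U c d (f d - f c) := by
  intro ε hε
  rcases le_or_gt c d with hcd | hcd
  swap
  · exact ⟨fun _ => 1, fun _ _ => one_pos, fun D _ => absurd
      ((D.le_pt le_rfl).trans (D.pt_last.le)) hcd.not_ge⟩
  -- The summand `1` keeps the denominator positive when `ψ d = ψ c`.
  set κ := ε / (ψ d - ψ c + 1)
  have hpos : 0 < ψ d - ψ c + 1 := by linarith [hψ hcd]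
  have hκ : 0 < κ := div_pos hε hpos
  have : ∀ τ, ∃ δ > 0, τ ∈ Icc c d → ∀ u, |u - τ| < δ →
      ‖f u - f τ - (U τ u - U τ τ)‖ ≤ κ * |ψ u - ψ τ| := by
    intro τ
    by_cases hτ : τ ∈ Icc c d
    · obtain ⟨δ, hδ, H⟩ := Metric.eventually_nhds_iff.1 ((hf τ hτ).def hκ)
      exact ⟨δ, hδ, fun _ u hu => H hu⟩
    · exact ⟨1, one_pos, fun h => absurd h hτ⟩
  choose δ hδ H using this
  refine ⟨δ, fun τ _ => hδ τ, fun D hD => ?_⟩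
  have := D.norm_sub_sum_le_of_gauge hψ (f := f) (fun τ hτ u _ => H τ hτ u) le_rfl le_rfl hD
  rw [norm_sub_rev]
  refine this.trans_lt ?_
  rw [div_mul_eq_mul_div, div_lt_iff₀ hpos]
  nlinarith

theorem hasKurzweilIntegral_of_isPrimitiveAt (hψ : Monotone ψ) {f : ℝ → E}
    (hf : ∀ τ, IsPrimitiveAt ψ U f τ) (a b : ℝ) : HasKurzweilIntegral U a b (f b - f a) := by
  refine ⟨fun _ => hasKurzweilIntegralOn_of_isPrimitiveAt hψ fun τ _ => hf τ, fun _ => ?_⟩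
  rw [neg_sub]
  exact hasKurzweilIntegralOn_of_isPrimitiveAt hψ fun τ _ => hf τ

/-- The analogue of "zero derivative implies constant": `f` is a primitive of the zero integrand. -/
theorem eq_of_increment_isLittleO (hψ : Monotone ψ) {f : ℝ → E} {c d : ℝ} (hcd : c ≤ d)
    (hf : ∀ τ ∈ Icc c d, (fun u => f u - f τ) =o[𝓝 τ] fun u => ψ u - ψ τ) : f d = f c := by
  have h := hasKurzweilIntegralOn_of_isPrimitiveAt (U := fun _ _ => (0 : E)) (f := f) hψ
    (c := c) (d := d) fun τ hτ => by simpa [IsPrimitiveAt] using hf τ hτ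
  have h0 := h.norm_le hcd (φ := fun _ => 0) (by simp)
  exact sub_eq_zero.1 (norm_le_zero_iff.1 (by simpa using h0))

/-- Primitives up to a relative error `ε` on the set `S`. -/
def HasApproxPrimitive (ψ : ℝ → ℝ) (U : ℝ → ℝ → E) (ε : ℝ) (S : Set ℝ) (f : ℝ → E) : Prop :=
  ∀ τ ∈ S, ∀ᶠ u in 𝓝 τ, u ∈ S → ‖f u - f τ - (U τ u - U τ τ)‖ ≤ ε * |ψ u - ψ τ|

theorem HasApproxPrimitive.glue {ε a b c : ℝ} {f g : ℝ → E}
    (hf : HasApproxPrimitive ψ U ε (Icc a b) f) (hg : HasApproxPrimitive ψ U ε (Icc b c) g) :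
    HasApproxPrimitive ψ U ε (Icc a c) fun t => if t ≤ b then f t else f b + (g t - g b) := by
  intro τ hτ
  rcases lt_trichotomy τ b with h | h | h
  · filter_upwards [hf τ ⟨hτ.1, h.le⟩, eventually_lt_nhds h] with u hu hub huS
    rw [if_pos hub.le, if_pos h.le]
    exact hu ⟨huS.1, hub.le⟩
  · subst h
    filter_upwards [hf τ ⟨hτ.1, le_rfl⟩, hg τ ⟨le_rfl, hτ.2⟩] with u hu hu' huS
    rcases le_or_gt u τ with h | h
    · rw [if_pos h, if_pos le_rfl]
      exact hu ⟨huS.1, h⟩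
    · rw [if_neg h.not_ge, if_pos le_rfl, add_sub_cancel_left]
      exact hu' ⟨h.le, huS.2⟩
  · filter_upwards [hg τ ⟨h.le, hτ.2⟩, eventually_gt_nhds h] with u hu hub huS
    rw [if_neg (not_le.2 hub), if_neg (not_le.2 h), add_sub_add_left_eq_sub, sub_sub_sub_cancel_right]
    exact hu ⟨le_of_lt hub, huS.2⟩

/-- The two-dimensional increments of `U` near the diagonal are locally dominated by products of
increments of `ψ`. -/
def LocallyDominated₂ (ψ : ℝ → ℝ) (U : ℝ → ℝ → E) : Prop :=
  ∀ p, ∃ K > 0, ∃ N ∈ 𝓝 p, ∀ τ ∈ N, ∀ σ ∈ N, ∀ u ∈ N, ∀ v ∈ N,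
    ‖U τ u - U τ v - (U σ u - U σ v)‖ ≤ K * |ψ τ - ψ σ| * |ψ u - ψ v|

theorem hasApproxPrimitive_of_oscillation {K ε x : ℝ} {S : Set ℝ} (hx : x ∈ S)
    (hU : ∀ τ ∈ S, ∀ σ ∈ S, ∀ u ∈ S, ∀ v ∈ S,
      ‖U τ u - U τ v - (U σ u - U σ v)‖ ≤ K * |ψ τ - ψ σ| * |ψ u - ψ v|)
    (h : ∀ t ∈ S, K * |ψ x - ψ t| ≤ ε) : HasApproxPrimitive ψ U ε S (U x) := by
  intro τ hτ
  filter_upwards with u hu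
  exact (hU x hx τ hτ u hu τ hτ).trans (by gcongr; exact h τ hτ)

/-- Used when `ψ` jumps at `x`, so that freezing the tag at `x` is too coarse. The tag is frozen at
`v`, beyond the jump, and the value at `x` is reset so that increments from `x` carry the jump of `U
x`. The error at `x` is measured against `|ψ t - ψ x|`, which is at least the jump. -/
theorem hasApproxPrimitive_of_jump {K ε x v : ℝ} {S : Set ℝ} (hx : x ∈ S) (hv : v ∈ S)
    (hU : ∀ τ ∈ S, ∀ σ ∈ S, ∀ u ∈ S, ∀ v ∈ S,
      ‖U τ u - U τ v - (U σ u - U σ v)‖ ≤ K * |ψ τ - ψ σ| * |ψ u - ψ v|)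
    (h : ∀ t ∈ S, t ≠ x → K * |ψ v - ψ t| ≤ ε ∧
      K * |ψ v - ψ x| * |ψ t - ψ v| ≤ ε * |ψ t - ψ x|) :
    HasApproxPrimitive ψ U ε S
      (Function.update (fun t => U v t - U v v + (U x v - U x x)) x 0) := by
  intro τ hτ
  rcases eq_or_ne τ x with rfl | hne
  · filter_upwards with u hu
    rcases eq_or_ne u τ with rfl | hu'
    · simp
    · rw [Function.update_of_ne hu', Function.update_self]
      refine le_trans (le_of_eq ?_) ((hU v hv τ hτ u hu v hv).trans (h u hu hu').2)
      congr 1; abel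
  · filter_upwards [isOpen_ne.mem_nhds hne] with u hne' hu
    rw [Function.update_of_ne hne, Function.update_of_ne hne', add_sub_add_right_eq_sub,
      sub_sub_sub_cancel_right]
    exact (hU v hv τ hτ u hu τ hτ).trans (by gcongr; exact (h τ hτ hne).1)

theorem exists_approxPrimitive_right (hψ : Monotone ψ) (hU : LocallyDominated₂ ψ U) {ε : ℝ}
    (hε : 0 < ε) (x : ℝ) :
    ∃ η > 0, ∀ v, x ≤ v → v < x + η → ∃ f, HasApproxPrimitive ψ U ε (Icc x v) f := by
  obtain ⟨K, hK, N, hN, H⟩ := hU x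
  obtain ⟨ρ, hρ, hρN⟩ := Metric.mem_nhds_iff.1 hN
  have hlim := hψ.tendsto_rightLim x
  set R := Function.rightLim ψ x
  have hsub : ∀ v, v < x + ρ → Icc x v ⊆ N := fun v hv t ht =>
    hρN (by rw [Metric.mem_ball, Real.dist_eq, abs_lt]; constructor <;> linarith [ht.1, ht.2])
  have hR : ∀ t, x < t → R ≤ ψ t := fun t ht => hψ.rightLim_le ht
  have hxR : ψ x ≤ R := hψ.le_rightLim le_rfl
  -- `κ` bounds the excess of `ψ` over `R` just right of `x`. In the jump case `κ ≤ R - ψ x` and `2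
  -- * K * κ ≤ ε` make the error at `x` at most `ε` times the jump.
  obtain ⟨κ, hκ, hκ1, hκ2⟩ : ∃ κ > 0, K * κ ≤ ε ∧
      (ψ x < R → K * (R - ψ x + κ) * κ ≤ ε * (R - ψ x)) := by
    by_cases hj : ψ x < R
    · refine ⟨min (R - ψ x) (ε / (2 * K)), lt_min (sub_pos.2 hj) (by positivity), ?_, fun _ => ?_⟩
      · have := min_le_right (R - ψ x) (ε / (2 * K))
        rw [le_div_iff₀ (by positivity)] at this
        nlinarith
      · have h1 := min_le_left (R - ψ x) (ε / (2 * K))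
        have h2 := min_le_right (R - ψ x) (ε / (2 * K))
        have h3 : 0 < min (R - ψ x) (ε / (2 * K)) := lt_min (sub_pos.2 hj) (by positivity)
        rw [le_div_iff₀ (by positivity)] at h2
        have hj := sub_pos.2 hj
        generalize min (R - ψ x) (ε / (2 * K)) = κ at *
        calc K * (R - ψ x + κ) * κ ≤ K * (2 * (R - ψ x)) * κ := by gcongr; linarith
          _ = (κ * (2 * K)) * (R - ψ x) := by ring
          _ ≤ _ := by gcongr
    · refine ⟨ε / K, by positivity, by field_simp; rfl, fun h => absurd h hj⟩
  obtain ⟨η, hη, hlt⟩ := mem_nhdsGT_iff_exists_Ioo_subset.1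
    (hlim.eventually (eventually_lt_nhds (lt_add_of_pos_right R hκ)))
  refine ⟨min ρ (η - x), lt_min hρ (sub_pos.2 hη), fun v hxv hv => ?_⟩
  have hv1 : v < x + ρ := hv.trans_le (by linarith [min_le_left ρ (η - x)])
  have hv2 : v < η := hv.trans_le (by linarith [min_le_right ρ (η - x)])
  have hN' := hsub v hv1
  have H' : ∀ τ ∈ Icc x v, ∀ σ ∈ Icc x v, ∀ u ∈ Icc x v, ∀ w ∈ Icc x v,
      ‖U τ u - U τ w - (U σ u - U σ w)‖ ≤ K * |ψ τ - ψ σ| * |ψ u - ψ w| :=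
    fun τ hτ σ hσ u hu w hw => H τ (hN' hτ) σ (hN' hσ) u (hN' hu) w (hN' hw)
  have hlt' : ∀ t ∈ Icc x v, x < t → ψ t < R + κ := fun t ht hxt => hlt ⟨hxt, ht.2.trans_lt hv2⟩
  by_cases hj : ψ x < R
  · refine ⟨_, hasApproxPrimitive_of_jump (left_mem_Icc.2 hxv) (right_mem_Icc.2 hxv) H'
      fun t ht htx => ?_⟩
    have hxt : x < t := lt_of_le_of_ne ht.1 htx.symm
    have h1 := hR t hxt
    have h2 := hlt' v (right_mem_Icc.2 hxv) (hxt.trans_le ht.2)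
    have h3 := hψ ht.2
    rw [abs_of_nonneg (by linarith), abs_of_nonneg (by linarith), abs_of_nonpos (by linarith),
      abs_of_nonneg (by linarith)]
    refine ⟨le_trans (by gcongr; linarith) hκ1, ?_⟩
    calc K * (ψ v - ψ x) * -(ψ t - ψ v) ≤ K * (R - ψ x + κ) * κ := by
          gcongr <;> linarith
      _ ≤ _ := hκ2 hj
      _ ≤ _ := by gcongr
  · refine ⟨_, hasApproxPrimitive_of_oscillation (left_mem_Icc.2 hxv) H' fun t ht => ?_⟩
    refine le_trans ?_ hκ1
    gcongr
    rw [abs_of_nonpos (sub_nonpos.2 (hψ ht.1))]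
    rcases ht.1.eq_or_lt with rfl | hxt
    · simpa using hκ.le
    · linarith [hlt' t ht hxt]

/-- The reflection `t ↦ -t` reduces left neighbourhoods to right ones; the outer sign in `-ψ (-t)`
preserves monotonicity. -/
theorem HasApproxPrimitive.reflect {ε a b : ℝ} {f : ℝ → E}
    (hf : HasApproxPrimitive (fun t => -ψ (-t)) (fun τ t => U (-τ) (-t)) ε (Icc (-b) (-a)) f) :
    HasApproxPrimitive ψ U ε (Icc a b) fun t => f (-t) := by
  intro τ hτ
  have h := (continuous_neg.tendsto τ).eventually (hf (-τ) ⟨neg_le_neg hτ.2, neg_le_neg hτ.1⟩)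
  filter_upwards [h] with u hu huS
  have := hu ⟨neg_le_neg huS.2, neg_le_neg huS.1⟩
  simp only [neg_neg] at this
  rwa [neg_sub_neg, abs_sub_comm] at this

theorem LocallyDominated₂.reflect (hU : LocallyDominated₂ ψ U) :
    LocallyDominated₂ (fun t => -ψ (-t)) (fun τ t => U (-τ) (-t)) := by
  intro p
  obtain ⟨K, hK, N, hN, H⟩ := hU (-p)
  refine ⟨K, hK, _, (continuous_neg.tendsto p) hN, fun τ hτ σ hσ u hu v hv => ?_⟩
  have := H _ hτ _ hσ _ hu _ hv
  rw [neg_sub_neg, neg_sub_neg, abs_sub_comm (ψ (-σ)), abs_sub_comm (ψ (-v))]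
  exact this

theorem exists_approxPrimitive (hψ : Monotone ψ) (hU : LocallyDominated₂ ψ U) {ε : ℝ}
    (hε : 0 < ε) {a b : ℝ} (hab : a ≤ b) : ∃ f, HasApproxPrimitive ψ U ε (Icc a b) f := by
  refine interval_induction (p := fun a b => ∃ f, HasApproxPrimitive ψ U ε (Icc a b) f) hab
    (fun _ _ _ _ _ _ _ ⟨f, hf⟩ ⟨g, hg⟩ => ⟨_, hf.glue hg⟩) fun x _ => ?_
  obtain ⟨η, hη, h⟩ := exists_approxPrimitive_right hψ hU hε x
  obtain ⟨η', hη', h'⟩ := exists_approxPrimitive_right (ψ := fun t => -ψ (-t))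
    (fun u v huv => neg_le_neg (hψ (neg_le_neg huv))) hU.reflect hε (-x)
  refine ⟨min η η', lt_min hη hη', fun u _ hu hux => ?_, fun v _ hxv hv =>
    h v hxv (hv.trans_le (by gcongr; exact min_le_left _ _))⟩
  obtain ⟨f, hf⟩ := h' (-u) (neg_le_neg hux) (by linarith [min_le_right η η'])
  exact ⟨_, hf.reflect⟩

theorem HasApproxPrimitive.exists_gauge {ε a b : ℝ} {f : ℝ → E}
    (hf : HasApproxPrimitive ψ U ε (Icc a b) f) :
    ∃ δ : ℝ → ℝ, (∀ τ, 0 < δ τ) ∧ ∀ τ ∈ Icc a b, ∀ u ∈ Icc a b, |u - τ| < δ τ →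
      ‖f u - f τ - (U τ u - U τ τ)‖ ≤ ε * |ψ u - ψ τ| := by
  have : ∀ τ, ∃ δ > 0, τ ∈ Icc a b → ∀ u ∈ Icc a b, |u - τ| < δ →
      ‖f u - f τ - (U τ u - U τ τ)‖ ≤ ε * |ψ u - ψ τ| := by
    intro τ
    by_cases hτ : τ ∈ Icc a b
    · obtain ⟨δ, hδ, H⟩ := Metric.eventually_nhds_iff.1 (hf τ hτ)
      exact ⟨δ, hδ, fun _ u huS hu => H hu huS⟩
    · exact ⟨1, one_pos, fun h => absurd h hτ⟩
  choose δ hδ H using this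
  exact ⟨δ, hδ, H⟩

theorem HasApproxPrimitive.norm_sub_integral_le (hψ : Monotone ψ) {ε a b c d : ℝ} {f : ℝ → E}
    {J : E} (hf : HasApproxPrimitive ψ U ε (Icc a b) f) (hac : a ≤ c) (hcd : c ≤ d) (hdb : d ≤ b)
    (hJ : HasKurzweilIntegralOn U c d J) : ‖f d - f c - J‖ ≤ ε * (ψ d - ψ c) := by
  obtain ⟨δ, hδ, H⟩ := hf.exists_gauge
  refine le_of_forall_pos_le_add fun κ hκ => ?_
  obtain ⟨δ', hδ', H'⟩ := hJ κ hκ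
  obtain ⟨D, hD⟩ := exists_isFine hcd (δ := fun τ => min (δ τ) (δ' τ))
    fun τ hτ => lt_min (hδ τ) (hδ' τ hτ)
  have h1 := D.norm_sub_sum_le_of_gauge hψ H hac hdb (hD.mono fun _ => min_le_left _ _)
  have h2 := H' D (hD.mono fun _ => min_le_right _ _)
  rw [show f d - f c - J = (f d - f c - D.sum U) + (D.sum U - J) by abel]
  exact (norm_add_le _ _).trans (by linarith)

/-- Increments of approximate primitives with errors `1 / (n + 1)` form a Cauchy sequence, because
any two of them are close to the sum over a common fine division. The limit is the integral. -/
theorem exists_hasKurzweilIntegralOn [CompleteSpace E] (hψ : Monotone ψ)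
    (hU : LocallyDominated₂ ψ U) {a b : ℝ} (hab : a ≤ b) :
    ∃ J, HasKurzweilIntegralOn U a b J := by
  choose f hf using fun n : ℕ =>
    exists_approxPrimitive hψ hU (ε := 1 / ((n : ℝ) + 1)) (by positivity) hab
  choose δ hδ H using fun n => (hf n).exists_gauge
  have key : ∀ n (D : TaggedDivision a b), D.IsFine (δ n) →
      ‖f n b - f n a - D.sum U‖ ≤ 1 / ((n : ℝ) + 1) * (ψ b - ψ a) := fun n D hD =>
    D.norm_sub_sum_le_of_gauge hψ (H n) le_rfl le_rfl hD
  have hV : 0 ≤ ψ b - ψ a := sub_nonneg.2 (hψ hab)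
  have hlim : Tendsto (fun n : ℕ => 1 / ((n : ℝ) + 1) * (ψ b - ψ a)) atTop (𝓝 0) := by
    simpa using (tendsto_one_div_add_atTop_nhds_zero_nat (𝕜 := ℝ)).mul_const (ψ b - ψ a)
  have hC : CauchySeq fun n => f n b - f n a := by
    refine cauchySeq_of_le_tendsto_0 (fun n : ℕ => 2 * (1 / ((n : ℝ) + 1) * (ψ b - ψ a)))
      (fun n m N hn hm => ?_) (by simpa using hlim.const_mul 2)
    obtain ⟨D, hD⟩ := exists_isFine hab (δ := fun τ => min (δ n τ) (δ m τ))
      fun τ _ => lt_min (hδ n τ) (hδ m τ)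
    have h1 := key n D (hD.mono fun _ => min_le_left _ _)
    have h2 := key m D (hD.mono fun _ => min_le_right _ _)
    have h3 : 1 / ((n : ℝ) + 1) * (ψ b - ψ a) ≤ 1 / ((N : ℝ) + 1) * (ψ b - ψ a) := by gcongr
    have h4 : 1 / ((m : ℝ) + 1) * (ψ b - ψ a) ≤ 1 / ((N : ℝ) + 1) * (ψ b - ψ a) := by gcongr
    rw [dist_eq_norm, show f n b - f n a - (f m b - f m a) =
      (f n b - f n a - D.sum U) - (f m b - f m a - D.sum U) by abel]
    exact (norm_sub_le _ _).trans (by linarith)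
  obtain ⟨J, hJ⟩ := cauchySeq_tendsto_of_complete hC
  refine ⟨J, fun ε hε => ?_⟩
  obtain ⟨n, hn1, hn2⟩ := ((hlim.eventually (eventually_lt_nhds (half_pos hε))).and
    (hJ.eventually (Metric.ball_mem_nhds J (half_pos hε)))).exists
  refine ⟨δ n, fun τ _ => hδ n τ, fun D hD => ?_⟩
  have h1 := key n D hD
  rw [dist_eq_norm] at hn2
  rw [show D.sum U - J = (f n b - f n a - J) - (f n b - f n a - D.sum U) by abel]
  exact (norm_sub_le _ _).trans_lt (by linarith)

/-- Existence of primitives. -/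
theorem exists_isPrimitiveAt [CompleteSpace E] (hψ : Monotone ψ) (hU : LocallyDominated₂ ψ U) :
    ∃ f : ℝ → E, ∀ τ, IsPrimitiveAt ψ U f τ := by
  have hex : ∀ a b, ∃ J, a ≤ b → HasKurzweilIntegralOn U a b J := fun a b => by
    by_cases hab : a ≤ b
    · obtain ⟨J, hJ⟩ := exists_hasKurzweilIntegralOn hψ hU hab
      exact ⟨J, fun _ => hJ⟩
    · exact ⟨0, fun h => absurd h hab⟩
  choose I hI using hex
  have hadd : ∀ a b c, a ≤ b → b ≤ c → I b c = I a c - I a b := fun a b c hab hbc =>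
    (hI b c hbc).unique hbc ((hI a b hab).sub_left hab (hI a c (hab.trans hbc)))
  set f : ℝ → E := fun t => if 0 ≤ t then I 0 t else - I t 0
  have hf : ∀ u v, u ≤ v → f v - f u = I u v := by
    intro u v huv
    simp only [f]
    rcases le_or_gt 0 u with hu | hu
    · rw [if_pos hu, if_pos (hu.trans huv), hadd 0 u v hu huv]
    · rcases le_or_gt 0 v with hv | hv
      · rw [if_neg hu.not_ge, if_pos hv, hadd u 0 v hu.le hv]; abel
      · rw [if_neg hu.not_ge, if_neg hv.not_ge, hadd u v 0 huv hv.le]; abel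
  refine ⟨f, fun τ => Asymptotics.isLittleO_iff.2 fun ε hε => ?_⟩
  -- `g` satisfies the pointwise relation up to `ε / 2`, and its increments differ from the
  -- integrals, hence from those of `f`, by another `ε / 2`.
  obtain ⟨g, hg⟩ := exists_approxPrimitive hψ hU (half_pos hε) (a := τ - 1) (b := τ + 1)
    (by linarith)
  filter_upwards [hg τ ⟨by linarith, by linarith⟩,
    Icc_mem_nhds (show τ - 1 < τ by linarith) (show τ < τ + 1 by linarith)] with u hu huS
  have h1 := hu huS
  have h2 : ‖g u - g τ - (f u - f τ)‖ ≤ ε / 2 * |ψ u - ψ τ| := by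
    rcases le_total τ u with h | h
    · rw [hf τ u h, abs_of_nonneg (sub_nonneg.2 (hψ h))]
      exact hg.norm_sub_integral_le hψ (by linarith) h huS.2 (hI _ _ h)
    · rw [abs_of_nonpos (sub_nonpos.2 (hψ h)), neg_sub, ← norm_neg,
        show -(g u - g τ - (f u - f τ)) = g τ - g u - (f τ - f u) by abel, hf u τ h]
      exact hg.norm_sub_integral_le hψ huS.1 h (by linarith) (hI _ _ h)
  rw [show f u - f τ - (U τ u - U τ τ) =
    (g u - g τ - (U τ u - U τ τ)) - (g u - g τ - (f u - f τ)) by abel, Real.norm_eq_abs]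
  exact (norm_sub_le _ _).trans (by linarith)

end Primitive

/-! ### Domination by monotone functions -/

section Domination

variable {E X Y : Type*} [NormedAddCommGroup E] [NormedAddCommGroup X] [NormedAddCommGroup Y]
  {ψ φ : ℝ → ℝ}

/-- The increments of `f` are locally dominated by those of `ψ`. -/
def LocallyDominated (ψ : ℝ → ℝ) (f : ℝ → E) : Prop :=
  ∀ p, ∃ K > 0, ∃ N ∈ 𝓝 p, ∀ x ∈ N, ∀ y ∈ N, ‖f x - f y‖ ≤ K * |ψ x - ψ y|

theorem abs_sub_le_abs_add_sub (hψ : Monotone ψ) (hφ : Monotone φ) (x y : ℝ) :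
    |ψ x - ψ y| ≤ |(ψ + φ) x - (ψ + φ) y| := by
  rcases le_total x y with h | h <;> have h1 := hψ h <;> have h2 := hφ h <;>
    simp only [Pi.add_apply]
  · rw [abs_of_nonpos (by linarith), abs_of_nonpos (by linarith)]; linarith
  · rw [abs_of_nonneg (by linarith), abs_of_nonneg (by linarith)]; linarith

theorem IsPrimitiveAt.add_right {U : ℝ → ℝ → E} {f : ℝ → E} {τ : ℝ} (h : IsPrimitiveAt ψ U f τ)
    (hψ : Monotone ψ) (hφ : Monotone φ) : IsPrimitiveAt (ψ + φ) U f τ :=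
  h.trans_le fun u => abs_sub_le_abs_add_sub hψ hφ u τ

theorem LocallyDominated.add_right {f : ℝ → E} (h : LocallyDominated ψ f) (hψ : Monotone ψ)
    (hφ : Monotone φ) : LocallyDominated (ψ + φ) f := fun p => by
  obtain ⟨K, hK, N, hN, H⟩ := h p
  exact ⟨K, hK, N, hN, fun x hx y hy => (H x hx y hy).trans
    (mul_le_mul_of_nonneg_left (abs_sub_le_abs_add_sub hψ hφ x y) hK.le)⟩

theorem LocallyDominated.of_le {f : ℝ → E} (h : ∀ x y, ‖f x - f y‖ ≤ |ψ x - ψ y|) :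
    LocallyDominated ψ f := fun p =>
  ⟨1, one_pos, univ, univ_mem, fun x _ y _ => by simpa using h x y⟩

theorem exists_monotone_dominating {f : ℝ → E} (hf : LocallyBoundedVariationOn f univ) :
    ∃ ψ : ℝ → ℝ, Monotone ψ ∧ ∀ x y, ‖f x - f y‖ ≤ |ψ x - ψ y| := by
  refine ⟨variationOnFromTo f univ 0,
    monotoneOn_univ.1 (variationOnFromTo.monotoneOn hf (mem_univ 0)), ?_⟩
  have key : ∀ x y, x ≤ y → ‖f x - f y‖ ≤
      |variationOnFromTo f univ 0 x - variationOnFromTo f univ 0 y| := fun x y hxy => by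
    rw [abs_sub_comm, variationOnFromTo.sub_right hf (mem_univ _) (mem_univ _) (mem_univ _),
      ← dist_eq_norm, variationOnFromTo.eq_of_le _ _ hxy, abs_of_nonneg ENNReal.toReal_nonneg]
    exact (hf x y (mem_univ _) (mem_univ _)).dist_le ⟨mem_univ _, le_rfl, hxy⟩
      ⟨mem_univ _, hxy, le_rfl⟩
  intro x y
  rcases le_total x y with h | h
  · exact key x y h
  · rw [norm_sub_rev, abs_sub_comm]; exact key y x h

theorem isBigO_one_of_monotone (hψ : Monotone ψ) (τ : ℝ) :
    (fun u => ψ u - ψ τ) =O[𝓝 τ] fun _ => (1 : ℝ) := by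
  refine Asymptotics.IsBigO.of_bound (ψ (τ + 1) - ψ (τ - 1)) ?_
  filter_upwards [Icc_mem_nhds (show τ - 1 < τ by linarith) (show τ < τ + 1 by linarith)]
    with u hu
  rw [norm_one, mul_one, Real.norm_eq_abs, abs_le]
  have h1 := hψ hu.1
  have h2 := hψ hu.2
  have h3 := hψ (show τ - 1 ≤ τ by linarith)
  have h4 := hψ (show τ ≤ τ + 1 by linarith)
  constructor <;> linarith

theorem LocallyDominated.isBigO {f : ℝ → E} (h : LocallyDominated ψ f) (τ : ℝ) :
    (fun u => f u - f τ) =O[𝓝 τ] fun u => ψ u - ψ τ := by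
  obtain ⟨K, -, N, hN, H⟩ := h τ
  refine Asymptotics.IsBigO.of_bound K ?_
  filter_upwards [hN] with u hu using H u hu τ (mem_of_mem_nhds hN)

theorem LocallyDominated.isBigO_one {f : ℝ → E} (h : LocallyDominated ψ f) (hψ : Monotone ψ)
    (τ : ℝ) : f =O[𝓝 τ] fun _ => (1 : ℝ) := by
  have h1 := (h.isBigO τ).trans (isBigO_one_of_monotone hψ τ)
  have h2 : (fun _ : ℝ => f τ) =O[𝓝 τ] fun _ => (1 : ℝ) := Asymptotics.isBigO_const_one ℝ _ _
  simpa using h1.add h2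

theorem LocallyDominated₂.of_le {U : ℝ → ℝ → E} {A : ℝ → X} {x : ℝ → Y}
    (hA : LocallyDominated ψ A) (hx : LocallyDominated ψ x)
    (h : ∀ τ σ u v, ‖U τ u - U τ v - (U σ u - U σ v)‖ ≤ ‖A u - A v‖ * ‖x τ - x σ‖) :
    LocallyDominated₂ ψ U := fun p => by
  obtain ⟨K, hK, N, hN, H⟩ := hA p
  obtain ⟨K', hK', N', hN', H'⟩ := hx p
  refine ⟨K * K', by positivity, N ∩ N', inter_mem hN hN', fun τ hτ σ hσ u hu v hv =>
    (h τ σ u v).trans ?_⟩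
  calc _ ≤ (K * |ψ u - ψ v|) * (K' * |ψ τ - ψ σ|) := by
        gcongr
        · exact H u hu.1 v hv.1
        · exact H' τ hτ.2 σ hσ.2
    _ = _ := by ring

end Domination

/-! ### Linear equation, adjoint equation and cocycle law in a normed ring -/

section Ring

variable {R : Type*} [NormedRing R] {ψ : ℝ → ℝ} {Λ X Y : ℝ → R} {τ : ℝ}

/-- At `τ`, `X` satisfies the linear equation with coefficient `Λ`. -/
def IsLinearAt (ψ : ℝ → ℝ) (Λ X : ℝ → R) (τ : ℝ) : Prop :=
  (fun u => X u - X τ - (Λ u - Λ τ) * X τ) =o[𝓝 τ] fun u => ψ u - ψ τ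

/-- At `τ`, `W` satisfies the adjoint linear equation with coefficient `Λ`. -/
def IsAdjointAt (ψ : ℝ → ℝ) (Λ W : ℝ → R) (τ : ℝ) : Prop :=
  (fun u => W u - W τ + W u * (Λ u - Λ τ)) =o[𝓝 τ] fun u => ψ u - ψ τ

theorem IsLinearAt.add_right {φ : ℝ → ℝ} (h : IsLinearAt ψ Λ X τ) (hψ : Monotone ψ)
    (hφ : Monotone φ) : IsLinearAt (ψ + φ) Λ X τ :=
  h.trans_le fun u => abs_sub_le_abs_add_sub hψ hφ u τ

theorem tendsto_nhdsGT_rightLim {E : Type*} [NormedAddCommGroup E] [CompleteSpace E] {f : ℝ → E}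
    (hf : LocallyBoundedVariationOn f univ) (t : ℝ) :
    Tendsto f (𝓝[>] t) (𝓝 (Function.rightLim f t)) := by
  apply tendsto_rightLim_of_tendsto
  have h := (hf (t - 1) (t + 1) (mem_univ _) (mem_univ _)).exists_tendsto_right t
  rwa [univ_inter, inter_comm, nhdsWithin_inter_of_mem' (mem_nhdsWithin_of_mem_nhds
    (Icc_mem_nhds (by linarith) (by linarith)))] at h

theorem tendsto_nhdsLT_leftLim {E : Type*} [NormedAddCommGroup E] [CompleteSpace E] {f : ℝ → E}
    (hf : LocallyBoundedVariationOn f univ) (t : ℝ) :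
    Tendsto f (𝓝[<] t) (𝓝 (Function.leftLim f t)) := by
  apply tendsto_leftLim_of_tendsto
  have h := (hf (t - 1) (t + 1) (mem_univ _) (mem_univ _)).exists_tendsto_left t
  rwa [univ_inter, inter_comm, nhdsWithin_inter_of_mem' (mem_nhdsWithin_of_mem_nhds
    (Icc_mem_nhds (by linarith) (by linarith)))] at h

theorem eventually_isUnit_of_tendsto [CompleteSpace R] {l : Filter ℝ} {a : R} (ha : IsUnit a)
    (hY : Tendsto Y l (𝓝 a)) :
    ∃ C, ∀ᶠ u in l, IsUnit (Y u) ∧ ‖Ring.inverse (Y u)‖ ≤ C := by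
  obtain ⟨a, rfl⟩ := ha
  have h1 := ((NormedRing.inverse_continuousAt a).tendsto.comp hY).norm
  exact ⟨_, (hY.eventually (Units.isOpen.mem_nhds a.isUnit)).and
    (h1.eventually (eventually_le_nhds (lt_add_one _)))⟩

/-- The one-sided limits of `Y` at `τ` are `1 + (Λ(τ±) - Λ(τ))`, invertible by hypothesis; units are
open and inversion is continuous at them. -/
theorem IsLinearAt.eventually_isUnit [CompleteSpace R] (hψ : Monotone ψ)
    (hΛ : LocallyBoundedVariationOn Λ univ) (hr : IsUnit (1 + (Function.rightLim Λ τ - Λ τ)))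
    (hl : IsUnit (1 - (Λ τ - Function.leftLim Λ τ))) (hY : IsLinearAt ψ Λ Y τ) (h1 : Y τ = 1) :
    ∃ C, ∀ᶠ u in 𝓝 τ, IsUnit (Y u) ∧ ‖Ring.inverse (Y u)‖ ≤ C := by
  have h0 := (Asymptotics.isLittleO_one_iff ℝ).1 (hY.trans_isBigO (isBigO_one_of_monotone hψ τ))
  have key : ∀ {l a}, l ≤ 𝓝 τ → Tendsto Λ l (𝓝 a) → Tendsto Y l (𝓝 (1 + (a - Λ τ))) := by
    intro l a hlτ hlim
    have h2 := (h0.mono_left hlτ).add ((hlim.sub_const (Λ τ)).const_add 1)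
    simp only [h1, mul_one, zero_add] at h2
    refine h2.congr fun u => ?_
    abel
  obtain ⟨C₁, hC₁⟩ := eventually_isUnit_of_tendsto hr
    (key nhdsWithin_le_nhds (tendsto_nhdsGT_rightLim hΛ τ))
  obtain ⟨C₂, hC₂⟩ := eventually_isUnit_of_tendsto hl
    (by rw [← neg_sub (Function.leftLim Λ τ), sub_neg_eq_add]
        exact key nhdsWithin_le_nhds (tendsto_nhdsLT_leftLim hΛ τ))
  refine ⟨max (max C₁ C₂) ‖(1 : R)‖, ?_⟩
  rw [← nhdsNE_sup_pure, ← nhdsLT_sup_nhdsGT, eventually_sup, eventually_sup, eventually_pure]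
  refine ⟨⟨hC₂.mono fun u hu => ⟨hu.1, hu.2.trans ?_⟩, hC₁.mono fun u hu => ⟨hu.1, hu.2.trans ?_⟩⟩,
    by simp [h1]⟩
  · exact (le_max_right _ _).trans (le_max_left _ _)
  · exact (le_max_left _ _).trans (le_max_left _ _)

/-- The relation for `X` is multiplied by `W u` on the left and `W τ` on the right; only boundedness
of `W` enters. -/
theorem IsLinearAt.isAdjointAt {W : ℝ → R} (hX : IsLinearAt ψ Λ X τ)
    (hWX : ∀ᶠ u in 𝓝 τ, W u * X u = 1) (hXW : X τ * W τ = 1)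
    (hW : W =O[𝓝 τ] fun _ => (1 : ℝ)) : IsAdjointAt ψ Λ W τ := by
  have h := (hW.mul_isLittleO hX).mul_isBigO
    (Asymptotics.isBigO_const_one ℝ (W τ) (𝓝 τ))
  simp only [one_mul, mul_one] at h
  refine h.neg_left.congr' ?_ .rfl
  filter_upwards [hWX] with u hu
  have e1 : W u * X u * W τ = W τ := by rw [hu, one_mul]
  have e2 : W u * (Λ u - Λ τ) * (X τ * W τ) = W u * (Λ u - Λ τ) := by rw [hXW, mul_one]
  have e3 : W u * (X τ * W τ) = W u := by rw [hXW, mul_one]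
  calc -(W u * (X u - X τ - (Λ u - Λ τ) * X τ) * W τ)
      = -(W u * X u * W τ) + W u * (X τ * W τ) + W u * (Λ u - Λ τ) * (X τ * W τ) := by
        noncomm_ring
    _ = _ := by rw [e1, e2, e3]; abel

theorem IsAdjointAt.mul_isLinearAt {W : ℝ → R} (hW : IsAdjointAt ψ Λ W τ)
    (hX : IsLinearAt ψ Λ X τ) (hWb : W =O[𝓝 τ] fun _ => (1 : ℝ)) :
    (fun u => W u * X u - W τ * X τ) =o[𝓝 τ] fun u => ψ u - ψ τ := by
  have h1 := hWb.mul_isLittleO hX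
  have h2 := hW.mul_isBigO (Asymptotics.isBigO_const_one ℝ (X τ) (𝓝 τ))
  simp only [one_mul, mul_one] at h1 h2
  refine (h1.add h2).congr_left fun u => ?_
  noncomm_ring

/-- A family of solutions of the linear equation, normalized by `V s s = 1`, whose members are
locally invertible at the base point. -/
structure IsEvolution (Λ : ℝ → R) (V : ℝ → ℝ → R) : Prop where
  self : ∀ s, V s s = 1
  linear : ∀ s, ∃ ψ : ℝ → ℝ, Monotone ψ ∧ LocallyDominated ψ (V · s) ∧
    ∀ τ, IsLinearAt ψ Λ (V · s) τ
  isUnit : ∀ s, ∃ C, ∀ᶠ u in 𝓝 s, IsUnit (V u s) ∧ ‖Ring.inverse (V u s)‖ ≤ C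

variable {V : ℝ → ℝ → R}

/-- By the product rule for an adjoint and a linear solution, `V(u,τ)⁻¹ V(u,s)` is constant for `u`
near `τ`. -/
theorem IsEvolution.eventually_eq_mul (hV : IsEvolution Λ V) (τ s : ℝ) :
    ∀ᶠ u in 𝓝 τ, V u s = V u τ * V τ s := by
  obtain ⟨C, hC⟩ := hV.isUnit τ
  obtain ⟨ψ₁, hψ₁, -, h₁⟩ := hV.linear τ
  obtain ⟨ψ₂, hψ₂, -, h₂⟩ := hV.linear s
  obtain ⟨ρ, hρ, H⟩ := Metric.eventually_nhds_iff_ball.1 hC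
  have hmono := hψ₁.add hψ₂
  have hder : ∀ σ ∈ Metric.ball τ ρ,
      (fun u => Ring.inverse (V u τ) * V u s - Ring.inverse (V σ τ) * V σ s) =o[𝓝 σ]
        fun u => (ψ₁ + ψ₂) u - (ψ₁ + ψ₂) σ := by
    intro σ hσ
    have hnear := Metric.isOpen_ball.mem_nhds hσ
    have hb : (fun u => Ring.inverse (V u τ)) =O[𝓝 σ] fun _ => (1 : ℝ) := by
      refine Asymptotics.IsBigO.of_bound C ?_
      filter_upwards [hnear] with u hu
      simpa using (H u hu).2
    have h₁' := (h₁ σ).add_right hψ₁ hψ₂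
    have h₂' : IsLinearAt (ψ₁ + ψ₂) Λ (V · s) σ := by
      rw [add_comm]; exact (h₂ σ).add_right hψ₂ hψ₁
    refine IsAdjointAt.mul_isLinearAt (W := fun u => Ring.inverse (V u τ)) (X := (V · s))
      (h₁'.isAdjointAt ?_ (Ring.mul_inverse_cancel _ (H σ hσ).1) hb) h₂' hb
    filter_upwards [hnear] with u hu using Ring.inverse_mul_cancel _ (H u hu).1
  filter_upwards [Metric.ball_mem_nhds τ hρ] with u hu
  have hconst : Ring.inverse (V u τ) * V u s = Ring.inverse (V τ τ) * V τ s := by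
    have hτ := Metric.mem_ball_self hρ (x := τ)
    rw [Real.ball_eq_Ioo] at *
    rcases le_total τ u with h | h
    · exact eq_of_increment_isLittleO hmono (f := fun u => Ring.inverse (V u τ) * V u s) h
        fun σ hσ => hder σ ⟨hτ.1.trans_le hσ.1, hσ.2.trans_lt hu.2⟩
    · exact (eq_of_increment_isLittleO hmono (f := fun u => Ring.inverse (V u τ) * V u s) h
        fun σ hσ => hder σ ⟨hu.1.trans_le hσ.1, hσ.2.trans_lt hτ.2⟩).symm
  rw [hV.self, Ring.inverse_one, one_mul] at hconst
  rw [← hconst, ← mul_assoc, Ring.mul_inverse_cancel _ (H u hu).1, one_mul]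

theorem IsEvolution.mul (hV : IsEvolution Λ V) (t r s : ℝ) : V t r * V r s = V t s := by
  -- Near `τ` both sides are the invertible `V u τ` times their values at `τ`, so the set where they
  -- agree is clopen; it contains `r`.
  have hiff : ∀ τ, ∀ᶠ u in 𝓝 τ, (V u r * V r s = V u s ↔ V τ r * V r s = V τ s) := by
    intro τ
    obtain ⟨C, hC⟩ := hV.isUnit τ
    filter_upwards [hV.eventually_eq_mul τ r, hV.eventually_eq_mul τ s, hC] with u h1 h2 h3
    rw [h1, h2, mul_assoc]
    exact h3.1.mul_right_inj
  have hclopen : IsClopen {u | V u r * V r s = V u s} := by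
    refine ⟨⟨isOpen_iff_mem_nhds.2 fun τ hτ => ?_⟩, isOpen_iff_mem_nhds.2 fun τ hτ => ?_⟩
    · filter_upwards [hiff τ] with u hu h using hτ (hu.1 h)
    · filter_upwards [hiff τ] with u hu using hu.2 hτ
  rcases isClopen_iff.1 hclopen with h | h
  · exact absurd (show r ∈ {u | V u r * V r s = V u s} by simp [hV.self]) (by simp [h])
  · exact (h.symm ▸ mem_univ t : t ∈ {u | V u r * V r s = V u s})

theorem IsEvolution.mul_cancel (hV : IsEvolution Λ V) (t s : ℝ) : V t s * V s t = 1 := by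
  rw [hV.mul, hV.self]

theorem IsEvolution.isBigO_one (hV : IsEvolution Λ V) (s τ : ℝ) :
    (fun u => V s u) =O[𝓝 τ] fun _ => (1 : ℝ) := by
  obtain ⟨C, hC⟩ := hV.isUnit τ
  refine Asymptotics.IsBigO.of_bound (‖V s τ‖ * C) ?_
  filter_upwards [hC] with u hu
  have : V τ u = Ring.inverse (V u τ) := by
    rw [← Ring.inverse_mul_cancel_left _ (V τ u) hu.1, hV.mul_cancel, mul_one]
  rw [← hV.mul s τ u, norm_one, mul_one, this]
  exact (norm_mul_le _ _).trans (by gcongr; exact hu.2)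

theorem IsEvolution.isAdjointAt (hV : IsEvolution Λ V) {s : ℝ} (h : IsLinearAt ψ Λ (V · s) τ) :
    IsAdjointAt ψ Λ (V s ·) τ :=
  h.isAdjointAt (.of_forall fun u => hV.mul_cancel s u) (hV.mul_cancel τ s) (hV.isBigO_one s τ)

theorem IsEvolution.locallyDominated (hV : IsEvolution Λ V) {s : ℝ}
    (h : LocallyDominated ψ (V · s)) : LocallyDominated ψ (V s ·) := by
  intro p
  obtain ⟨K, hK, N, hN, H⟩ := h p
  obtain ⟨C, hC, hb⟩ := (hV.isBigO_one s p).exists_pos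
  refine ⟨C * K * C, by positivity, _, inter_mem hN hb.bound, fun x hx y hy => ?_⟩
  have hx2 : ‖V s x‖ ≤ C := by simpa using hx.2
  have hy2 : ‖V s y‖ ≤ C := by simpa using hy.2
  have e : V s x - V s y = - (V s x * (V x s - V y s) * V s y) := by
    rw [mul_sub, hV.mul_cancel, sub_mul, mul_assoc, hV.mul_cancel]; noncomm_ring
  calc ‖V s x - V s y‖ = ‖V s x * (V x s - V y s) * V s y‖ := by rw [e, norm_neg]
    _ ≤ ‖V s x‖ * ‖V x s - V y s‖ * ‖V s y‖ := norm_mul₃_le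
    _ ≤ C * (K * |ψ x - ψ y|) * C := by
        gcongr
        exact H x hx.1 y hy.1
    _ = _ := by ring

end Ring

/-! ### Variation of constants and the exponential dichotomy -/

section VariationOfConstants

variable {𝕜 : Type*} [RCLike 𝕜] {Z : Type*} [NormedAddCommGroup Z] [NormedSpace 𝕜 Z]
  {ψ : ℝ → ℝ} {Λ X W : ℝ → Z →L[𝕜] Z} {g q w : ℝ → Z} {τ s : ℝ}

theorem isLittleO_apply {A : ℝ → Z →L[𝕜] Z} {x : ℝ → Z} {l : Filter ℝ} {k : ℝ → ℝ}
    (hA : A =O[l] fun _ => (1 : ℝ)) (hx : x =o[l] k) : (fun u => A u (x u)) =o[l] k := by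
  have h := hA.norm_left.mul_isLittleO hx.norm_left
  simp only [one_mul] at h
  refine (Asymptotics.IsBigO.of_bound 1 (.of_forall fun u => ?_)).trans_isLittleO h
  simpa using (A u).le_opNorm (x u)

theorem isLittleO_apply_const {A : ℝ → Z →L[𝕜] Z} {l : Filter ℝ} {k : ℝ → ℝ}
    (hA : A =o[l] k) (x : Z) : (fun u => A u x) =o[l] k := by
  refine (Asymptotics.IsBigO.of_bound ‖x‖ (.of_forall fun u => ?_)).trans_isLittleO hA
  simpa [mul_comm] using (A u).le_opNorm x

/-- Reduction of the nonhomogeneous linear equation to a quadrature, by the adjoint solution. -/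
theorem IsAdjointAt.variation_of_constants (hW : IsAdjointAt ψ Λ W τ)
    (hWb : W =O[𝓝 τ] fun _ => (1 : ℝ)) (hw : IsPrimitiveAt ψ (fun τ t => W t (g τ)) w τ)
    (hq : IsPrimitiveAt ψ (fun τ t => Λ t (q τ + g τ)) q τ) :
    (fun u => (W u (q u) + w u) - (W τ (q τ) + w τ)) =o[𝓝 τ] fun u => ψ u - ψ τ := by
  -- The `Λ` terms cancel between the first two errors, the `g τ` terms between the last two.
  have h := ((isLittleO_apply hWb hq).add (isLittleO_apply_const hW (q τ + g τ))).add hw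
  refine h.congr_left fun u => ?_
  simp only [map_sub, map_add, add_apply, sub_apply, mul_apply_eq_comp]
  abel

/-- The variation of constants formula produces solutions. -/
theorem IsLinearAt.variation_of_constants (hX : IsLinearAt ψ Λ X τ)
    (hXb : X =O[𝓝 τ] fun _ => (1 : ℝ)) (hXW : ∀ u, X u * W u = 1)
    (hw : IsPrimitiveAt ψ (fun τ t => W t (g τ)) w τ) (c : Z) :
    IsPrimitiveAt ψ (fun τ t => Λ t (X τ (c - w τ) + g τ)) (fun t => X t (c - w t)) τ := by
  -- The last summand, the linear relation applied to `W τ (g τ)`, supplies the term `(Λ u - Λ τ) (g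
  -- τ)`.
  have h := ((isLittleO_apply_const hX (c - w τ)).sub (isLittleO_apply hXb hw)).add
    (isLittleO_apply_const hX (W τ (g τ)))
  have e : ∀ u x, X u (W u x) = x := fun u x => DFunLike.congr_fun (hXW u) x
  refine h.congr_left fun u => ?_
  simp only [map_sub, map_add, sub_apply, mul_apply_eq_comp, e]
  abel

theorem IsPrimitiveAt.clm_apply (L : Z →L[𝕜] Z)
    (hw : IsPrimitiveAt ψ (fun τ t => W t (g τ)) w τ) :
    IsPrimitiveAt ψ (fun τ t => (L * W t) (g τ)) (fun t => L (w t)) τ := by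
  refine ((L.isBigO_comp _ _).trans_isLittleO hw).congr_left fun u => ?_
  simp

/-- Freezing a function left of `s` keeps its bound, now on the whole line, where primitives are
built. -/
theorem norm_sub_max_le {E : Type*} [NormedAddCommGroup E] {f : ℝ → E} (hψ : Monotone ψ)
    (hf : ∀ c d, s ≤ c → c ≤ d → ‖f d - f c‖ ≤ ψ d - ψ c) (x y : ℝ) :
    ‖f (max x s) - f (max y s)‖ ≤ |ψ x - ψ y| := by
  have key : ∀ x y, x ≤ y → ‖f (max y s) - f (max x s)‖ ≤ |ψ y - ψ x| := fun x y hxy => by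
    rw [abs_of_nonneg (sub_nonneg.2 (hψ hxy))]
    refine (hf _ _ (le_max_right _ _) (max_le_max_right s hxy)).trans ?_
    rcases le_total y s with h | h
    · rw [max_eq_right h, max_eq_right (hxy.trans h), sub_self]
      exact sub_nonneg.2 (hψ hxy)
    · rw [max_eq_left h]
      gcongr
      exact hψ (le_max_left _ _)
  rcases le_total x y with h | h
  · rw [norm_sub_rev, abs_sub_comm]; exact key x y h
  · exact key y x h

variable {V : ℝ → ℝ → Z →L[𝕜] Z} {P : ℝ → Z →L[𝕜] Z}

theorem IsFundamentalOperator.isEvolution [CompleteSpace Z] (hΛ : IsAdmissible Λ)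
    (hV : IsFundamentalOperator Λ V) : IsEvolution Λ V := by
  have hself : ∀ s, V s s = 1 := fun s => by
    have h := (hV.integral_eq s s).1 le_rfl
    have h0 := h.norm_le le_rfl (φ := fun _ => 0) fun τ u v h1 h2 h3 h4 => by
      obtain rfl : u = v := by linarith
      simp
    rw [sub_self] at h0
    exact sub_eq_zero.1 (norm_le_zero_iff.1 h0)
  have hlin : ∀ s, ∃ ψ : ℝ → ℝ, Monotone ψ ∧ LocallyDominated ψ (V · s) ∧
      ∀ τ, IsLinearAt ψ Λ (V · s) τ := fun s => by
    obtain ⟨φ, hφ, hφΛ⟩ := exists_monotone_dominating hΛ.locallyBV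
    obtain ⟨χ, hχ, hχV⟩ := exists_monotone_dominating (hV.locallyBV s)
    have hΛd := (LocallyDominated.of_le hφΛ).add_right hφ hχ
    have hVd := (LocallyDominated.of_le hχV).add_right hχ hφ
    rw [add_comm χ] at hVd
    have hU : LocallyDominated₂ (φ + χ) fun τ r => (Λ r).comp (V τ s) :=
      .of_le hΛd hVd fun τ σ u v => by
        rw [← ContinuousLinearMap.sub_comp, ← ContinuousLinearMap.sub_comp,
          ← ContinuousLinearMap.comp_sub]
        exact ContinuousLinearMap.opNorm_comp_le _ _
    obtain ⟨f, hf⟩ := exists_isPrimitiveAt (hφ.add hχ) hU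
    -- By uniqueness of the integral, `V(·,s)` inherits the pointwise relation from the primitive
    -- `f`.
    have hfV : ∀ t, V t s - 1 = f t - f s := fun t =>
      (hV.integral_eq t s).unique (hasKurzweilIntegral_of_isPrimitiveAt (hφ.add hχ) hf s t)
    refine ⟨_, hφ.add hχ, hVd, fun τ => (hf τ).congr_left fun u => ?_⟩
    rw [show f u - f τ = V u s - V τ s by
      rw [← sub_sub_sub_cancel_right (f u) (f τ) (f s), ← hfV, ← hfV, sub_sub_sub_cancel_right],
      sub_mul]
    rfl
  refine ⟨hself, hlin, fun s => ?_⟩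
  obtain ⟨ψ, hψ, -, h⟩ := hlin s
  exact (h s).eventually_isUnit hψ hΛ.locallyBV (hΛ.isUnit_right s) (hΛ.isUnit_left s) (hself s)

/-- The right-hand side depends on `σ` only through `V s σ`, so a single primitive `w` serves every
`t`. -/
theorem IsEvolution.comp_projection (hV : IsEvolution Λ V)
    (hP : IsExponentialDichotomy V P) (s t σ : ℝ) :
    (V t σ).comp (P σ) = V t s * P s * V s σ := by
  rw [← hP.invariant, ← hV.mul t s σ]
  change P t * (V t s * V s σ) = _
  rw [← mul_assoc]
  congr 1
  exact hP.invariant t s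

theorem IsEvolution.comp_complementary (hV : IsEvolution Λ V)
    (hP : IsExponentialDichotomy V P) (s t σ : ℝ) :
    (V t σ).comp (ContinuousLinearMap.id 𝕜 Z - P σ) = V t s * (1 - P s) * V s σ := by
  rw [ContinuousLinearMap.comp_sub, hV.comp_projection hP s, ContinuousLinearMap.comp_id, mul_sub,
    mul_one, sub_mul, hV.mul]

/-- The quadrature of the variation of constants formula. -/
theorem IsEvolution.exists_quadrature [CompleteSpace Z] (hV : IsEvolution Λ V) {φ : ℝ → ℝ} (hφ : Monotone φ)
    (hg : ∀ x y, ‖g x - g y‖ ≤ |φ x - φ y|) (s : ℝ) :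
    ∃ ψ : ℝ → ℝ, Monotone ψ ∧ (∀ x y, |φ x - φ y| ≤ |ψ x - ψ y|) ∧
      (∀ τ, IsLinearAt ψ Λ (V · s) τ) ∧ (∀ τ, (V · s) =O[𝓝 τ] fun _ => (1 : ℝ)) ∧
      ∃ w : ℝ → Z, ∀ τ, IsPrimitiveAt ψ (fun τ t => V s t (g τ)) w τ := by
  obtain ⟨χ, hχ, hd, hlin⟩ := hV.linear s
  have hle := abs_sub_le_abs_add_sub hφ hχ
  refine ⟨φ + χ, hφ.add hχ, hle, fun τ => add_comm χ φ ▸ (hlin τ).add_right hχ hφ,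
    hd.isBigO_one hχ, exists_isPrimitiveAt (hφ.add hχ) ?_⟩
  refine .of_le (hV.locallyDominated (add_comm χ φ ▸ hd.add_right hχ hφ))
    (.of_le fun x y => (hg x y).trans (hle x y)) fun τ σ u v => ?_
  rw [← sub_apply, ← sub_apply, ← map_sub]
  exact ContinuousLinearMap.le_opNorm _ _

/-- `(1 - P(s))V(s,t) = V(s,t)(1 - P(t))`, whose norm is at most `K e^{α(s-t)}` for `t > s`. -/
theorem IsExponentialDichotomy.tendsto_zero (hV : IsEvolution Λ V)
    (hP : IsExponentialDichotomy V P) {x : ℝ → Z} {C : ℝ} (hx : ∀ t ≥ s, ‖x t‖ ≤ C) :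
    Tendsto (fun t => (1 - P s) (V s t (x t))) atTop (𝓝 0) := by
  obtain ⟨K, hK, α, hα, -, hb⟩ := hP.bounds
  have hlim : Tendsto (fun t => K * Real.exp (α * (s - t)) * C) atTop (𝓝 0) := by
    have h1 : Tendsto (fun t => α * (s - t)) atTop atBot :=
      (tendsto_atBot_add_const_left atTop s tendsto_neg_atTop_atBot).const_mul_atBot hα |>.congr
        fun t => by ring
    simpa using ((Real.tendsto_exp_atBot.comp h1).const_mul K).mul_const C
  refine squeeze_zero_norm' ?_ hlim
  filter_upwards [eventually_gt_atTop s] with t ht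
  have e := hV.comp_complementary hP s s t
  rw [hV.self, one_mul] at e
  have h1 : (1 - P s) (V s t (x t)) =
      (V s t).comp (ContinuousLinearMap.id 𝕜 Z - P t) (x t) := by rw [e]; rfl
  rw [h1]
  refine (ContinuousLinearMap.le_opNorm _ _).trans ?_
  gcongr
  · exact hb s t ht
  · exact hx t ht.le

end VariationOfConstants

/-! ### The two implications -/

section LyapunovPerron

variable {𝕜 : Type*} [RCLike 𝕜] {Z : Type*} [NormedAddCommGroup Z] [NormedSpace 𝕜 Z]
  {Λ : ℝ → Z →L[𝕜] Z} {V : ℝ → ℝ → Z →L[𝕜] Z} {P : ℝ → Z →L[𝕜] Z}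
  {F : Z → ℝ → Z} {h : ℝ → ℝ} {s : ℝ} {z : ℝ → Z}

/-- This regularity of bounded solutions makes `F(z(τ), t)` and `Λ(t)z(τ)` separately integrable;
the equation only integrates their sum. -/
theorem IsSolution.norm_sub_le (hF : IsClassF F h) (hz : IsSolution Λ F s z) {N : ℝ}
    (hN : ∀ t ≥ s, ‖z t‖ ≤ N) {φ : ℝ → ℝ} (hφ : Monotone φ)
    (hφΛ : ∀ x y, ‖Λ x - Λ y‖ ≤ |φ x - φ y|) {c d : ℝ} (hc : s ≤ c) (hcd : c ≤ d) :
    ‖z d - z c‖ ≤ (N * φ d + h d) - (N * φ c + h c) := by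
  refine ((hz c d hc hcd).1 hcd).norm_le hcd (φ := fun t => N * φ t + h t) fun τ u v h1 h2 h3 _ => ?_
  have huv := h2.trans h3
  have e1 : ‖(Λ v - Λ u) (z τ)‖ ≤ (φ v - φ u) * N := by
    refine (ContinuousLinearMap.le_opNorm _ _).trans ?_
    have := hφΛ v u
    rw [abs_of_nonneg (sub_nonneg.2 (hφ huv))] at this
    exact mul_le_mul this (hN τ (by linarith)) (norm_nonneg _) (sub_nonneg.2 (hφ huv))
  have e2 := hF.bound (z τ) u v
  rw [abs_of_nonneg (sub_nonneg.2 (hF.mono huv))] at e2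
  calc ‖Λ v (z τ) + F (z τ) v - (Λ u (z τ) + F (z τ) u)‖
      = ‖(Λ v - Λ u) (z τ) + (F (z τ) v - F (z τ) u)‖ := by
        rw [sub_apply]; congr 1; abel
    _ ≤ _ := norm_add_le _ _
    _ ≤ _ := by linarith

theorem IsClassF.norm_integral_le (hF : IsClassF F h) {c d : ℝ} (hcd : c ≤ d) {J : Z}
    (hJ : HasKurzweilIntegralOn (fun τ t => F (z τ) t) c d J) : ‖J‖ ≤ h d - h c :=
  hJ.norm_le hcd fun τ u v _ h2 h3 _ => by
    have := hF.bound (z τ) u v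
    rwa [abs_of_nonneg (sub_nonneg.2 (hF.mono (h2.trans h3)))] at this

theorem solvesLyapunovPerron_of_isSolution [CompleteSpace Z] (hΛ : IsAdmissible Λ) (hV : IsEvolution Λ V)
    (hP : IsExponentialDichotomy V P) (hF : IsClassF F h) (hh : BoundedVariationOn h univ)
    {N : ℝ} (hN : ∀ t ≥ s, ‖z t‖ ≤ N) (hz : IsSolution Λ F s z) :
    SolvesLyapunovPerron V P F s z := by
  obtain ⟨φ, hφ, hφΛ⟩ := exists_monotone_dominating hΛ.locallyBV
  have hN0 : 0 ≤ N := (norm_nonneg _).trans (hN s le_rfl)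
  have hχ : Monotone fun t => N * φ t + h t := (hφ.const_mul hN0).add hF.mono
  set zs : ℝ → Z := fun t => z (max t s)
  have hzs : ∀ t, s ≤ t → zs t = z t := fun t ht => by simp only [zs, max_eq_left ht]
  have hzd : ∀ x y, ‖zs x - zs y‖ ≤ |(N * φ x + h x) - (N * φ y + h y)| :=
    norm_sub_max_le hχ fun c d hc hcd => hz.norm_sub_le hF hN hφ hφΛ hc hcd
  have hmono₁ := hχ.add hF.mono
  obtain ⟨G, hG⟩ : ∃ G : ℝ → Z, ∀ τ,
      IsPrimitiveAt ((fun t => N * φ t + h t) + h) (fun τ t => F (zs τ) t) G τ := by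
    refine exists_isPrimitiveAt hmono₁ (.of_le (A := h) (x := zs)
      (add_comm h _ ▸ (LocallyDominated.of_le fun x y => le_rfl).add_right hF.mono hχ)
      ((LocallyDominated.of_le hzd).add_right hχ hF.mono) fun τ σ u v => ?_)
    have := hF.lipschitz (zs τ) (zs σ) v u
    rw [mul_comm, Real.norm_eq_abs]
    refine le_trans (le_of_eq ?_) this
    congr 1; abel
  obtain ⟨L, hL⟩ : ∃ L : ℝ → Z, ∀ τ,
      IsPrimitiveAt ((fun t => N * φ t + h t) + φ) (fun τ t => Λ t (zs τ)) L τ := by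
    refine exists_isPrimitiveAt (hχ.add hφ) (.of_le (A := Λ) (x := zs)
      (add_comm φ _ ▸ (LocallyDominated.of_le hφΛ).add_right hφ hχ)
      ((LocallyDominated.of_le hzd).add_right hχ hφ) fun τ σ u v => ?_)
    rw [← sub_apply, ← sub_apply, ← map_sub]
    exact ContinuousLinearMap.le_opNorm _ _
  have hGint : ∀ a b, HasKurzweilIntegralOn (fun τ t => F (zs τ) t) a b (G b - G a) := fun a b =>
    hasKurzweilIntegralOn_of_isPrimitiveAt hmono₁ fun τ _ => hG τ
  have hLint : ∀ a b, HasKurzweilIntegralOn (fun τ t => Λ t (zs τ)) a b (L b - L a) := fun a b =>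
    hasKurzweilIntegralOn_of_isPrimitiveAt (hχ.add hφ) fun τ _ => hL τ
  set g : ℝ → Z := fun t => G t - G s
  have hgd : ∀ x y, ‖g x - g y‖ ≤ |h x - h y| := by
    have key : ∀ x y, x ≤ y → ‖g y - g x‖ ≤ |h y - h x| := fun x y hxy => by
      rw [sub_sub_sub_cancel_right, abs_of_nonneg (sub_nonneg.2 (hF.mono hxy))]
      exact hF.norm_integral_le hxy (hGint x y)
    intro x y
    rcases le_total x y with hxy | hxy
    · rw [norm_sub_rev, abs_sub_comm]; exact key x y hxy
    · exact key y x hxy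
  have hmono₂ : Monotone ((fun t => N * φ t + h t) + φ + h) := (hχ.add hφ).add hF.mono
  obtain ⟨ψ, hψ, hle, hlin, -, w, hw⟩ := hV.exists_quadrature hmono₂ (g := g)
    (fun x y => (hgd x y).trans
      (add_comm h _ ▸ abs_sub_le_abs_add_sub hF.mono (hχ.add hφ) x y)) s
  -- The part `q = z - g` satisfies `dq = d[Λ](q + g)`, to which the adjoint reduction applies.
  have hzq : ∀ t, s ≤ t → z t = (z s + (L t - L s)) + g t := fun t ht => by
    have h1 := ((hLint s t).add (hGint s t)).congr
      (U' := fun τ t => Λ t (z τ) + F (z τ) t) fun τ hτ t => by rw [hzs τ hτ.1]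
    rw [add_assoc, ← ((hz s t le_rfl ht).1 ht).unique ht h1]
    abel
  have hq : ∀ τ, s ≤ τ → IsPrimitiveAt ψ
      (fun τ t => Λ t ((z s + (L τ - L s)) + g τ)) (fun t => z s + (L t - L s)) τ := fun τ hτ => by
    have h1 : IsPrimitiveAt ψ (fun τ t => Λ t (zs τ)) L τ :=
      ((hL τ).add_right (hχ.add hφ) hF.mono).trans_le fun u => hle u τ
    refine h1.congr_left fun u => ?_
    beta_reduce
    rw [← hzq τ hτ, hzs τ hτ]
    abel
  have hsol : ∀ t, s ≤ t → V s t (z t - g t) + w t = z s + w s := fun t ht => by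
    have h1 := eq_of_increment_isLittleO hψ ht fun τ hτ =>
      (hV.isAdjointAt (hlin τ)).variation_of_constants (hV.isBigO_one s τ) (hw τ) (hq τ hτ.1)
    rw [hzq t ht, add_sub_cancel_right]
    simpa [hV.self] using h1
  have hvoc : ∀ t, s ≤ t → z t = V t s (z s - (w t - w s)) + g t := fun t ht => by
    have h1 : z s - (w t - w s) = V s t (z t - g t) := by
      rw [eq_sub_of_add_eq (hsol t ht)]; abel
    have h2 : V t s (V s t (z t - g t)) = z t - g t :=
      DFunLike.congr_fun (hV.mul_cancel t s) _
    rw [h1, h2, sub_add_cancel]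
  have hgb : ∀ t, ‖g t‖ ≤ (eVariationOn h univ).toReal := fun t => by
    have h1 := hgd t s
    rw [show g s = 0 from sub_self _, sub_zero, ← Real.dist_eq] at h1
    exact h1.trans (hh.dist_le (mem_univ _) (mem_univ _))
  -- `1 - P s` is applied to the conserved quantity `hsol`; its term in `z - g` decays by the
  -- dichotomy.
  have hlim : Tendsto (fun T => (1 - P s) (w T - w s)) atTop (𝓝 ((1 - P s) (z s))) := by
    have h1 := hP.tendsto_zero hV (x := fun t => z t - g t) (s := s)
      (C := N + (eVariationOn h univ).toReal) fun t ht =>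
        (norm_sub_le _ _).trans (add_le_add (hN t ht) (hgb t))
    have h2 := h1.const_sub ((1 - P s) (z s))
    rw [sub_zero] at h2
    refine h2.congr' ?_
    filter_upwards [eventually_ge_atTop s] with t ht
    rw [← map_sub, eq_sub_of_add_eq (hsol t ht)]
    congr 1; abel
  refine ⟨g, fun σ hσ => ((hGint s σ).congr fun τ hτ t => by
    rw [hzs τ hτ.1]).hasKurzweilIntegral hσ, fun t ht =>
    ⟨V t s (P s (w t - w s)), V t s ((1 - P s) (z s) - (1 - P s) (w t - w s)), ?_,
      ⟨fun T => V t s ((1 - P s) (w T - w t)), fun T _ => ?_, ?_⟩, ?_⟩⟩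
  · simp only [HasPerronStieltjes, hV.comp_projection hP s t]
    have h1 := hasKurzweilIntegral_of_isPrimitiveAt hψ
      (fun τ => (hw τ).clm_apply (V t s * P s)) s t
    rwa [← map_sub] at h1
  · simp only [HasPerronStieltjes, hV.comp_complementary hP s t]
    have h1 := hasKurzweilIntegral_of_isPrimitiveAt hψ
      (fun τ => (hw τ).clm_apply (V t s * (1 - P s))) t T
    rwa [← map_sub] at h1
  · refine (((V t s).continuous.tendsto _).comp (hlim.sub_const ((1 - P s) (w t - w s)))).congr
      fun T => ?_
    simp only [Function.comp_apply, ← map_sub, sub_sub_sub_cancel_right]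
  · rw [hvoc t ht]
    simp only [map_sub, sub_apply, one_apply_eq_self]
    abel

theorem isSolution_of_solvesLyapunovPerron [CompleteSpace Z] (hV : IsEvolution Λ V)
    (hP : IsExponentialDichotomy V P) (hF : IsClassF F h)
    (hz : SolvesLyapunovPerron V P F s z) : IsSolution Λ F s z := by
  obtain ⟨g, hg, hJ⟩ := hz
  have hgint : ∀ c d, s ≤ c → c ≤ d →
      HasKurzweilIntegralOn (fun τ t => F (z τ) t) c d (g d - g c) := fun c d hc hcd =>
    ((hg c hc).1 hc).sub_left hc ((hg d (hc.trans hcd)).1 (hc.trans hcd))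
  set gs : ℝ → Z := fun t => g (max t s)
  have hgs : ∀ t, s ≤ t → gs t = g t := fun t ht => by simp only [gs, max_eq_left ht]
  have hgd : ∀ x y, ‖gs x - gs y‖ ≤ |h x - h y| := norm_sub_max_le hF.mono fun c d hc hcd =>
    hF.norm_integral_le hcd (hgint c d hc hcd)
  obtain ⟨ψ, hψ, -, hlin, hb, w, hw⟩ := hV.exists_quadrature hF.mono hgd s
  have hint : ∀ (A : Z →L[𝕜] Z) a b,
      HasKurzweilIntegralOn (fun τ t => (A * V s t) (gs τ)) a b (A (w b - w a)) := fun A a b => by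
    rw [map_sub]
    exact hasKurzweilIntegralOn_of_isPrimitiveAt hψ fun τ _ => (hw τ).clm_apply A
  have hJ₁ : ∀ t J, s ≤ t → HasPerronStieltjes (fun σ => (V t σ).comp (P σ)) g s t J →
      J = V t s (P s (w t - w s)) := fun t J ht hJ => by
    simp only [HasPerronStieltjes, hV.comp_projection hP s t] at hJ
    exact ((hJ.1 ht).congr fun τ hτ r => by rw [← hgs τ hτ.1]).unique ht (hint (V t s * P s) s t)
  have hJ₂ : ∀ t J, s ≤ t → HasPerronStieltjesAtTop
      (fun σ => (V t σ).comp (ContinuousLinearMap.id 𝕜 Z - P σ)) g t J →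
      Tendsto (fun T => V t s ((1 - P s) (w T - w t))) atTop (𝓝 J) := fun t J ht ⟨I, hI, hlim⟩ => by
    refine hlim.congr' ?_
    filter_upwards [eventually_ge_atTop t] with T hT
    have h1 := hI T hT
    simp only [HasPerronStieltjes, hV.comp_complementary hP s t] at h1
    exact ((h1.1 hT).congr fun τ hτ r => by rw [← hgs τ (ht.trans hτ.1)]).unique hT
      (hint (V t s * (1 - P s)) t T)
  -- At `t = s` the improper integral is `C = lim (1 - P s) (w T - w s)`; its values at all other
  -- `t` are expressed through `C`.
  obtain ⟨-, C, -, hC, -⟩ := hJ s le_rfl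
  replace hC := hJ₂ s C le_rfl hC
  simp only [hV.self, one_apply_eq_self] at hC
  set c : Z := P s (z s) + C + w s
  have hzq : ∀ t, s ≤ t → z t = V t s (c - w t) + g t := fun t ht => by
    obtain ⟨J₁, J₂, h1, h2, h3⟩ := hJ t ht
    have e1 := hJ₁ t J₁ ht h1
    have e2 : J₂ = V t s (C - (1 - P s) (w t - w s)) := by
      refine tendsto_nhds_unique (hJ₂ t J₂ ht h2) (((V t s).continuous.tendsto _).comp
        (hC.sub_const ((1 - P s) (w t - w s))) |>.congr fun T => ?_)
      simp only [Function.comp_apply, ← map_sub, sub_sub_sub_cancel_right]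
    rw [h3, e1, e2]
    simp only [c, map_sub, map_add, sub_apply, one_apply_eq_self]
    abel
  intro a b ha hab
  have h1 : HasKurzweilIntegralOn (fun τ t => Λ t (V τ s (c - w τ) + gs τ)) a b
      (V b s (c - w b) - V a s (c - w a)) :=
    hasKurzweilIntegralOn_of_isPrimitiveAt hψ fun τ _ =>
      (hlin τ).variation_of_constants (hb τ) (fun u => hV.mul_cancel u s) (hw τ) c
  have h2 := (h1.congr (U' := fun τ t => Λ t (z τ)) fun τ hτ t => by
    rw [hgs τ (ha.trans hτ.1), ← hzq τ (ha.trans hτ.1)]).add (hgint a b ha hab)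
  rw [hzq a ha, hzq b (ha.trans hab), add_sub_add_comm]
  exact h2.hasKurzweilIntegral hab

end LyapunovPerron

end GODE

theorem lemma3p2 {𝕜 : Type*} [RCLike 𝕜] {Z : Type*} [NormedAddCommGroup Z] [NormedSpace 𝕜 Z]
    [CompleteSpace Z]
    (Λ : ℝ → Z →L[𝕜] Z) (hΛ : GODE.IsAdmissible Λ)
    (V : ℝ → ℝ → Z →L[𝕜] Z) (hV : GODE.IsFundamentalOperator Λ V)
    (P : ℝ → Z →L[𝕜] Z) (hP : GODE.IsExponentialDichotomy V P)
    (F : Z → ℝ → Z) (h : ℝ → ℝ) (hF : GODE.IsClassF F h)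
    (hh : BoundedVariationOn h Set.univ) (s : ℝ) :
    (∀ z : ℝ → Z, (∃ N : ℝ, ∀ t ≥ s, ‖z t‖ ≤ N) → GODE.IsSolution Λ F s z →
      GODE.SolvesLyapunovPerron V P F s z) ∧
    (∀ z : ℝ → Z, GODE.SolvesLyapunovPerron V P F s z → GODE.IsSolution Λ F s z) := by
  have hE := hV.isEvolution hΛ
  exact ⟨fun z ⟨_, hN⟩ hz => GODE.solvesLyapunovPerron_of_isSolution hΛ hE hP hF hh hN hz,
    fun z hz => GODE.isSolution_of_solvesLyapunovPerron hE hP hF hz⟩
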